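/- **Theorem (Limit laws for affine balanced two-color urn models).** Let $m\ge 1$ and $\sigma\ge 1$ be integers and let $a_k,b_k$ ($0\le k\le m$) be integers with $a_k+b_k=\sigma$ for all $k$. An urn initially contains $W_0$ white and $B_0$ black balls, with $T_0=W_0+B_0\ge m$. At each step a sample of $m$ balls is drawn, either always without replacement (model $\mathcal M$) or always with replacement (model $\mathcal R$), and put back; if it contains $k$ white and $m-k$ black balls, then $a_{m-k}$ white and $b_{m-k}$ black balls are added (a negative number means removal). Thus, if the urn contains $w$ white and $b$ black balls, the sample contains exactly $k$ white balls with conditional probability $\binom wk\binom b{m-k}/\binom{w+b}m$ in model $\mathcal M$ and $\binom mk w^kb^{m-k}/(w+b)^m$ in model $\mathcal R$. Let $W_n$ and $B_n$ be the numbers of white and black balls after $n$ draws, so that $W_n+B_n=T_n=T_0+\sigma n$. Assume that the urn is *tenable* (no composition with a negative number of balls of some color is reached with positive probability) and *affine* (there are deterministic sequences $\alpha_n,\beta_n$ such that for every $n\ge1$ and every composition of $T_{n-1}$ balls, $w$ of them white, the expected number of white balls after the $n$-th draw from that composition is $\alpha_n w+\beta_n$). Put $$\Lambda=\frac m\sigma\,(a_{m-1}-a_m),$$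 that is, $m$ times the ratio of the eigenvalues $a_{m-1}-a_m$ and $\sigma$ of $\begin{pmatrix}a_{m-1}&b_{m-1}\\a_m&b_m\end{pmatrix}$. Then: 1. *Small-index urns.* If $a_m\ne0$, $b_0\neq 0$, $\Lambda\le\frac12$ and $\Lambda\ne0$, then $\dfrac{W_n-\mathbb E(W_n)}{\sqrt{\mathbb V(W_n)}}\to\mathcal N(0,1)$ in distribution. 2. *Large-index urns.* If $\Lambda>\frac12$, then there is a random variable $L$ with $\dfrac{W_n-\mathbb E(W_n)}{n^\Lambda}\to L$ almost surely. 3. *Triangular urns.* Let $\Lambda>0$. If $a_m=0$, then there is a random variable $T$ with $\dfrac{W_n}{n^\Lambda}\to T$ almost surely. If $b_0=0$, then there is a random variable $T$ with $\dfrac{B_n}{n^\Lambda}\to T$ almost surely. Moreover, in cases 2 and 3 all positive integer moments converge: for every integer $s\ge1$ the $s$-th moment of the limit exists (is finite), and the $s$-th moments of the normalized random variables converge to it. -/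

import Mathlib

open MeasureTheory ProbabilityTheory Filter Topology

noncomputable section

/-- The two ways of drawing a sample from the urn: without replacement (model `ℳ`, all balls of the
sample are drawn at once), or with replacement (model `ℛ`, balls are drawn one at a time and each is
put back before the next one is drawn). -/
inductive SamplingModel where
  | withoutReplacement
  | withReplacement

/-- The probability that a sample of size `m` from an urn with `w` white and `b` black balls contains
exactly `k` white balls: hypergeometric in the model without replacement, binomial in the model with
replacement. -/
def SamplingModel.drawProb (S : SamplingModel) (m w b k : ℕ) : ℝ :=
  match S with
  | .withoutReplacement => ((w.choose k : ℝ) * (b.choose (m - k) : ℝ)) / ((w + b).choose m : ℝ)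
  | .withReplacement =>
      (m.choose k : ℝ) * (w : ℝ) ^ k * (b : ℝ) ^ (m - k) / ((w : ℝ) + (b : ℝ)) ^ m

/-- The data of a balanced two-color urn scheme with sample size `m ≥ 1`, balance `σ ≥ 1` and initial
numbers of balls `W0`, `B0`. Whenever the sample contains `k` white and `m - k` black balls, the sample
is put back and `a (m - k)` white and `b (m - k)` black balls are added (negative numbers mean
removal). Only the values `a k`, `b k` for `k ≤ m` matter. -/
structure BalancedUrn where
  m : ℕ
  σ : ℕ
  W0 : ℕ
  B0 : ℕ
  a : ℕ → ℤ
  b : ℕ → ℤ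
  one_le_m : 1 ≤ m
  one_le_σ : 1 ≤ σ
  balanced : ∀ k ≤ m, a k + b k = (σ : ℤ)
  m_le_initial : m ≤ W0 + B0

namespace BalancedUrn

/-- The (deterministic) total number of balls `T_n = T_0 + σ n` after `n` draws. -/
def total (U : BalancedUrn) (n : ℕ) : ℕ := U.W0 + U.B0 + U.σ * n

/-- The urn index `Λ = (m / σ) (a_{m-1} - a_m)`. It is `m` times the ratio of the two eigenvalues
`a_{m-1} - a_m` and `σ` of the matrix with rows `(a_{m-1}, b_{m-1})` and `(a_m, b_m)`. -/
def index (U : BalancedUrn) : ℝ := (U.m : ℝ) / (U.σ : ℝ) * ((U.a (U.m - 1) : ℝ) - (U.a U.m : ℝ))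

/-- `U.Reachable S w b`: with positive probability the urn contains, after some number of draws, `w`
white and `b` black balls. (Negative numbers would mean that balls have to be removed that are not
there; draws are continued only from genuine urn contents.) -/
inductive Reachable (U : BalancedUrn) (S : SamplingModel) : ℤ → ℤ → Prop
  | start : Reachable U S (U.W0 : ℤ) (U.B0 : ℤ)
  | step (w b k : ℕ) : Reachable U S (w : ℤ) (b : ℤ) → k ≤ U.m → 0 < S.drawProb U.m w b k →
      Reachable U S ((w : ℤ) + U.a (U.m - k)) ((b : ℤ) + U.b (U.m - k))

/-- The urn is tenable: drawing and replacing can be continued forever, since no reachable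
configuration has a negative number of balls of some color. -/
def IsTenable (U : BalancedUrn) (S : SamplingModel) : Prop :=
  ∀ w b : ℤ, U.Reachable S w b → 0 ≤ w ∧ 0 ≤ b

/-- The urn scheme is affine: there are deterministic sequences `α`, `β` such that, whatever the
composition of the urn before the `(n+1)`-st draw (`w` white and `b` black balls, `T_n` in total), the
expected number of white balls after that draw is `α_{n+1} w + β_{n+1}`. -/
def IsAffine (U : BalancedUrn) (S : SamplingModel) : Prop :=
  ∃ α β : ℕ → ℝ, ∀ n w b : ℕ, w + b = U.total n →
    (w : ℝ) + ∑ k ∈ Finset.range (U.m + 1), S.drawProb U.m w b k * (U.a (U.m - k) : ℝ)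
      = α (n + 1) * (w : ℝ) + β (n + 1)

variable {Ω : Type*}

/-- The number `W_n` of white balls after `n` draws; `K i` is the number of white balls in the
`(i+1)`-st sample. -/
def white (U : BalancedUrn) (K : ℕ → Ω → Fin (U.m + 1)) (n : ℕ) (ω : Ω) : ℤ :=
  (U.W0 : ℤ) + ∑ i ∈ Finset.range n, U.a (U.m - (K i ω : ℕ))

/-- The number `B_n` of black balls after `n` draws. -/
def black (U : BalancedUrn) (K : ℕ → Ω → Fin (U.m + 1)) (n : ℕ) (ω : Ω) : ℤ :=
  (U.B0 : ℤ) + ∑ i ∈ Finset.range n, U.b (U.m - (K i ω : ℕ))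

/-- The sigma-algebra `ℱ_n` generated by the first `n` draws. -/
abbrev drawSigma (U : BalancedUrn) (K : ℕ → Ω → Fin (U.m + 1)) (n : ℕ) : MeasurableSpace Ω :=
  ⨆ i ∈ Finset.range n, MeasurableSpace.comap (K i) inferInstance

/-- `K` is the sequence of draws of the urn `U` under the sampling model `S`: given the first `n`
draws, the next sample contains `k` white balls with the probability prescribed by the sampling model
for the current composition `(W_n, B_n)` of the urn. (For tenable urns `W_n` and `B_n` are almost
surely nonnegative, so that `toNat` does not change them.) -/
structure IsDrawSequence [MeasurableSpace Ω] (U : BalancedUrn) (S : SamplingModel) (P : Measure Ω)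
    (K : ℕ → Ω → Fin (U.m + 1)) : Prop where
  measurable : ∀ n, Measurable (K n)
  condProb : ∀ (n : ℕ) (k : Fin (U.m + 1)),
    P⟦K n ⁻¹' {k} | U.drawSigma K n⟧
      =ᵐ[P] fun ω => S.drawProb U.m (U.white K n ω).toNat (U.black K n ω).toNat (k : ℕ)

end BalancedUrn

/-- The real random variables `X n` converge almost surely to the random variable `Z`, and all positive
integer moments of `X n` converge to those of `Z`, which exist. -/
structure ConvergesWithMoments {Ω : Type*} [MeasurableSpace Ω] (P : Measure Ω) (X : ℕ → Ω → ℝ)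
    (Z : Ω → ℝ) : Prop where
  measurable_limit : Measurable Z
  tendsto_ae : ∀ᵐ ω ∂P, Tendsto (fun n => X n ω) atTop (𝓝 (Z ω))
  integrable_pow : ∀ s : ℕ, 1 ≤ s → ∀ n, Integrable (fun ω => X n ω ^ s) P
  integrable_limit_pow : ∀ s : ℕ, 1 ≤ s → Integrable (fun ω => Z ω ^ s) P
  tendsto_moment : ∀ s : ℕ, 1 ≤ s →
    Tendsto (fun n => ∫ ω, X n ω ^ s ∂P) atTop (𝓝 (∫ ω, Z ω ^ s ∂P))

end

/-! The whole proof rests on linearity. The laws of a sample, over all compositions of a fixed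
total, separate the functions on `0, ..., m`; since the mean number of white balls in a sample is `m
w / (w + b)`, affinity forces `a (m - k)` to be affine in `k`, with some slope `s`
(`IsAffine.a_eq`). Hence the increment of `W_n` is `a_m + s k`, and for every `c` with `c (n+1) = g
n * c n + a_m` the process `Y = W - c` satisfies `E[Y (n+1) | ℱ n] = g n * Y n`, where `g n = 1 + m
s / T_n = 1 + Λ / (n + T_0 / σ)`. Its innovations are bounded, and their conditional variance is `s
^ 2` times the variance of one sample. This structure, `IsLinearRecursion`, is all that the limit
theorems use. The partial products `β n` of the `g n` are a ratio of Gamma functions times a power,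
of order `n ^ Λ`, and `Y n / β n` is a martingale as long as they stay positive.

Strong limits. If the conditional variance of the next martingale increment is at most `ε n * (1 + M
n ^ 2)` with `ε` summable, every even moment of the martingale `M` stays bounded
(`exists_moment_le`); Doob's theorem and uniform integrability then give almost sure convergence
with all moments. For `Λ > 1/2`, bounded innovations suffice, because `β n ^ (-2)` is summable. In
the triangular cases `W` or `B` itself is a linear recursion, and the sample variance is at most `m
^ 2` times the proportion of that color; this makes `ε n` of order `n ^ (-1 - Λ)`, summable for
every `Λ > 0`.

Normal limit. For `Λ ≤ 1/2` the sum of `β n ^ (-2)` diverges and no single term dominates.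
Tenability makes `a_m` and `b_0` positive, and the proportion of white balls tends in mean square to
`a_m / (a_m + b_0)`, strictly between 0 and 1. The conditional variances thus converge in mean to a
positive constant, and a step-by-step comparison of characteristic functions with Gaussian factors
(`norm_integral_exp_step_le`, `norm_sub_exp_mul_le_sum`) yields the central limit theorem. -/

namespace SamplingModel

/-! ### Moments of one sample and the shape of affine urns. -/

lemma drawProb_nonneg (S : SamplingModel) (m w b k : ℕ) : 0 ≤ S.drawProb m w b k := by
  cases S <;> simp only [drawProb] <;> positivity

lemma drawProb_withReplacement_eq_eval {m w b k : ℕ} (hk : k ≤ m) (hT : 0 < w + b) :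
    withReplacement.drawProb m w b k
      = (bernsteinPolynomial ℝ m k).eval ((w : ℝ) / ((w : ℝ) + b)) := by
  have hT' : ((w : ℝ) + b) ≠ 0 := by exact_mod_cast hT.ne'
  have h1 : (1 : ℝ) - w / ((w : ℝ) + b) = b / ((w : ℝ) + b) := by field_simp; ring
  obtain ⟨j, rfl⟩ := Nat.exists_eq_add_of_le hk
  simp only [drawProb, bernsteinPolynomial, Polynomial.eval_mul, Polynomial.eval_pow,
    Polynomial.eval_sub, Polynomial.eval_one, Polynomial.eval_X, Polynomial.eval_natCast, h1]
  rw [div_pow, div_pow, Nat.add_sub_cancel_left, pow_add]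
  field_simp

lemma sum_drawProb (S : SamplingModel) {m w b : ℕ} (hT : m ≤ w + b) (hT0 : 0 < w + b) :
    ∑ k ∈ Finset.range (m + 1), S.drawProb m w b k = 1 := by
  cases S with
  | withoutReplacement =>
    simp only [drawProb]
    rw [← Finset.sum_div, div_eq_one_iff_eq]
    · rw [Nat.add_choose_eq, Finset.Nat.sum_antidiagonal_eq_sum_range_succ
        (fun i j => w.choose i * b.choose j)]
      push_cast; rfl
    · exact_mod_cast (Nat.choose_pos hT).ne'
  | withReplacement =>
    rw [Finset.sum_congr rfl fun k hk => drawProb_withReplacement_eq_eval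
      (Nat.lt_succ_iff.1 (Finset.mem_range.1 hk)) hT0, ← Polynomial.eval_finsetSum,
      bernsteinPolynomial.sum, Polynomial.eval_one]

/-- Size-biasing: by the absorption identity for binomial coefficients, a factor `k` sets one white
ball aside and leaves a sample of size `m` from `w` white and `b` black balls. Iterating this gives
the hypergeometric moments. -/
lemma sum_mul_drawProb_withoutReplacement_succ (φ : ℕ → ℝ) {m w b : ℕ} (hT : m ≤ w + b) :
    ∑ k ∈ Finset.range (m + 2), k * φ k * withoutReplacement.drawProb (m + 1) (w + 1) b k
      = (m + 1) * ((w + 1) / ((w : ℝ) + 1 + b)) *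
        ∑ k ∈ Finset.range (m + 1), φ (k + 1) * withoutReplacement.drawProb m w b k := by
  rw [Finset.sum_range_succ', Finset.mul_sum]
  simp only [Nat.cast_zero, zero_mul, add_zero]
  refine Finset.sum_congr rfl fun k hk => ?_
  simp only [drawProb]
  have h1 : ((w : ℝ) + 1) * w.choose k = (w + 1).choose (k + 1) * (k + 1) := by
    exact_mod_cast Nat.add_one_mul_choose_eq w k
  have h2 : ((w : ℝ) + b + 1) * (w + b).choose m = (w + b + 1).choose (m + 1) * (m + 1) := by
    exact_mod_cast Nat.add_one_mul_choose_eq (w + b) m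
  have h3 : (0 : ℝ) < (w + b).choose m := by exact_mod_cast Nat.choose_pos hT
  have h4 : (0 : ℝ) < (w + b + 1).choose (m + 1) := by
    exact_mod_cast Nat.choose_pos (by omega)
  rw [show w + 1 + b = w + b + 1 by ring, show m + 1 - (k + 1) = m - k by omega,
    show (w : ℝ) + 1 + b = w + b + 1 by ring]
  have h5 : (0 : ℝ) < (w : ℝ) + b + 1 := by positivity
  push_cast
  field_simp
  calc _ = φ (k + 1) * (b.choose (m - k)) * (((w + 1).choose (k + 1) * (k + 1)) *
        (((w : ℝ) + b + 1) * (w + b).choose m)) := by ring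
    _ = φ (k + 1) * (b.choose (m - k)) * ((((w : ℝ) + 1) * w.choose k) *
        ((w + b + 1).choose (m + 1) * (m + 1))) := by rw [h1, h2]
    _ = _ := by ring

lemma sum_mul_drawProb_withoutReplacement_zero (φ : ℕ → ℝ) {m b : ℕ} :
    ∑ k ∈ Finset.range (m + 1), k * φ k * withoutReplacement.drawProb m 0 b k = 0 := by
  refine Finset.sum_eq_zero fun k _ => ?_
  rcases k with _ | k <;> simp [drawProb]

lemma sum_mul_drawProb (S : SamplingModel) {m w b : ℕ} (hT : m ≤ w + b) (hT0 : 0 < w + b) :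
    ∑ k ∈ Finset.range (m + 1), k * S.drawProb m w b k = m * (w / ((w : ℝ) + b)) := by
  cases S with
  | withoutReplacement =>
    rcases m with _ | m
    · simp
    rcases w with _ | w
    · simpa using sum_mul_drawProb_withoutReplacement_zero (fun _ => 1) (m := m + 1) (b := b)
    have h := sum_mul_drawProb_withoutReplacement_succ (fun _ => 1) (m := m) (w := w) (b := b)
      (by omega)
    -- With one ball set aside the urn may be empty, a case that `sum_drawProb` does not cover.
    rcases Nat.eq_zero_or_pos (w + b) with h0 | h0
    · obtain rfl : m = 0 := by omega
      obtain ⟨rfl, rfl⟩ : w = 0 ∧ b = 0 := by omega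
      simp [drawProb, Finset.sum_range_succ]
    · simp only [one_mul, mul_one] at h
      rw [h, sum_drawProb _ (by omega) h0]
      push_cast; ring
  | withReplacement =>
    rw [Finset.sum_congr rfl fun k hk => by rw [drawProb_withReplacement_eq_eval
      (Nat.lt_succ_iff.1 (Finset.mem_range.1 hk)) hT0]]
    have h := congrArg (Polynomial.eval ((w : ℝ) / ((w : ℝ) + b))) (bernsteinPolynomial.sum_smul ℝ m)
    simpa [Polynomial.eval_finsetSum] using h

/-- The binomial second moment is exact with replacement. Without replacement it is corrected by the
finite-population term, which is of order one over the total; so both models share the same limiting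
variance. -/
lemma sum_sq_mul_drawProb (S : SamplingModel) {m w b : ℕ} (hT : m ≤ w + b) (hT0 : 0 < w + b) :
    |∑ k ∈ Finset.range (m + 1), (k : ℝ) ^ 2 * S.drawProb m w b k
      - (m * (m - 1) * (w / ((w : ℝ) + b)) ^ 2 + m * (w / ((w : ℝ) + b)))|
      ≤ m ^ 2 / ((w : ℝ) + b) := by
  have hT0' : (0 : ℝ) < (w : ℝ) + b := by exact_mod_cast hT0
  cases S with
  | withoutReplacement =>
    rcases m with _ | m
    · simp
    rcases w with _ | w
    · have := sum_mul_drawProb_withoutReplacement_zero (fun k => (k : ℝ)) (m := m + 1) (b := b)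
      simp only [← sq] at this
      rw [this]
      simp
      positivity
    have h := sum_mul_drawProb_withoutReplacement_succ (fun k => (k : ℝ)) (m := m) (w := w) (b := b)
      (by omega)
    simp only [← sq] at h
    rw [h]
    rcases Nat.eq_zero_or_pos (w + b) with h0 | h0
    · obtain rfl : m = 0 := by omega
      obtain ⟨rfl, rfl⟩ : w = 0 ∧ b = 0 := by omega
      simp [drawProb]
    · push_cast
      simp only [add_mul, one_mul, Finset.sum_add_distrib]
      rw [sum_drawProb _ (by omega) h0, sum_mul_drawProb _ (by omega) h0]
      have h1 : (0 : ℝ) < w + b := by exact_mod_cast h0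
      have h2 : (0 : ℝ) < w + 1 + b := by positivity
      have key : ((m : ℝ) * ((w + 1) / (w + 1 + b)) + (w + 1) / (w + 1 + b)) *
          (m * (w / (w + b)) + 1) - ((m + 1) * (m + 1 - 1) * ((w + 1) / (w + 1 + b)) ^ 2
            + (m + 1) * ((w + 1) / (w + 1 + b)))
          = - ((m + 1) * m * ((w + 1) / (w + 1 + b)) * (b / (w + b)) / ((w : ℝ) + 1 + b)) := by
        field_simp
        ring
      have h3 : ((w : ℝ) + 1) / (w + 1 + b) ≤ 1 := by
        rw [div_le_one h2]; linarith [(Nat.cast_nonneg b : (0 : ℝ) ≤ b)]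
      have h4 : (b : ℝ) / (w + b) ≤ 1 := by
        rw [div_le_one h1]; linarith [(Nat.cast_nonneg w : (0 : ℝ) ≤ w)]
      have e : ∀ x y z : ℝ, x = y → |y| ≤ z → |x| ≤ z := by rintro x _ z rfl h; exact h
      refine e _ _ _ (Eq.trans ?_ key) ?_
      · ring
      rw [abs_neg, abs_of_nonneg (by positivity)]
      refine div_le_div_of_nonneg_right ?_ h2.le
      calc _ ≤ ((m : ℝ) + 1) * m * 1 * 1 := by gcongr
        _ ≤ _ := by nlinarith [(Nat.cast_nonneg m : (0 : ℝ) ≤ m)]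
  | withReplacement =>
    have h := congrArg (Polynomial.eval ((w : ℝ) / ((w : ℝ) + b)))
      (bernsteinPolynomial.sum_mul_smul ℝ m)
    have h' := sum_mul_drawProb withReplacement hT hT0
    have key : ∑ k ∈ Finset.range (m + 1), (k : ℝ) ^ 2 * withReplacement.drawProb m w b k
        = m * (m - 1) * (w / ((w : ℝ) + b)) ^ 2 + m * (w / ((w : ℝ) + b)) := by
      have e : ∀ n : ℕ, ((n * (n - 1) : ℕ) : ℝ) = (n : ℝ) * (n - 1) := by
        rintro (_ | n) <;> simp
      rw [← h', ← e]
      simp only [Polynomial.eval_finsetSum, nsmul_eq_mul, Polynomial.eval_mul,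
        Polynomial.eval_natCast, Polynomial.eval_pow, Polynomial.eval_X] at h
      rw [← h, ← Finset.sum_add_distrib]
      refine Finset.sum_congr rfl fun k hk => ?_
      rw [drawProb_withReplacement_eq_eval (Nat.lt_succ_iff.1 (Finset.mem_range.1 hk)) hT0, e]
      ring
    rw [key, sub_self, abs_zero]
    positivity

/-- Without replacement the system is triangular: an urn with `k` white balls never yields more than
`k` of them. With replacement it says that a polynomial in the odds `w / b` has too many roots. -/
lemma eq_zero_of_sum_drawProb_mul_eq_zero (S : SamplingModel) {m T : ℕ} (hm : 1 ≤ m) (hT : m ≤ T)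
    (d : ℕ → ℝ) (hd : ∀ w b : ℕ, w + b = T →
      ∑ k ∈ Finset.range (m + 1), S.drawProb m w b k * d k = 0) :
    ∀ k ≤ m, d k = 0 := by
  cases S with
  | withoutReplacement =>
    intro k
    induction k using Nat.strong_induction_on with
    | _ k ih =>
      intro hk
      have h := hd k (T - k) (by omega)
      rw [Finset.sum_eq_single k] at h
      · refine (mul_eq_zero.1 h).resolve_left (ne_of_gt ?_)
        have h1 : 0 < (T - k).choose (m - k) := Nat.choose_pos (by omega)
        have h2 : 0 < (k + (T - k)).choose m := Nat.choose_pos (by omega)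
        simp only [drawProb, Nat.choose_self]
        positivity
      · intro j hj hjk
        rcases lt_or_gt_of_ne hjk with h' | h'
        · rw [ih j h' (by omega), mul_zero]
        · simp [drawProb, Nat.choose_eq_zero_of_lt h']
      · intro h'
        simp at h'
        omega
  | withReplacement =>
    have hdm : d m = 0 := by
      have h := hd T 0 (by omega)
      have hT0 : (T : ℝ) ≠ 0 := by exact_mod_cast (by omega : T ≠ 0)
      rw [Finset.sum_eq_single m] at h
      · simpa [drawProb, hT0] using h
      · intro j hj hjm
        have : m - j ≠ 0 := by simp at hj; omega
        simp [drawProb, this]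
      · simp
    -- As `d m = 0`, the polynomial has degree below `m`. The compositions with `i < m` white balls
    -- provide `m` distinct roots `i / (T - i)`, the denominators being positive because `m ≤ T`.
    set q : Polynomial ℝ := ∑ k ∈ Finset.range m, Polynomial.monomial k (m.choose k * d k) with hq
    have heval : ∀ i : Fin m, q.eval (((i : ℕ) : ℝ) / (T - (i : ℕ) : ℕ)) = 0 := by
      intro i
      have hb : ((T - (i : ℕ) : ℕ) : ℝ) ≠ 0 := by exact_mod_cast (by omega : T - (i : ℕ) ≠ 0)
      have h := hd i (T - i) (by omega)
      have hT0 : ((i : ℕ) : ℝ) + (T - (i : ℕ) : ℕ) ≠ 0 := by positivity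
      rw [Finset.sum_range_succ, hdm, mul_zero, add_zero] at h
      have h2 : q.eval (((i : ℕ) : ℝ) / (T - (i : ℕ) : ℕ)) * ((T - (i : ℕ) : ℕ) : ℝ) ^ m
          = (((i : ℕ) : ℝ) + (T - (i : ℕ) : ℕ)) ^ m * 0 := by
        rw [← h, hq, Polynomial.eval_finsetSum, Finset.sum_mul, Finset.mul_sum]
        refine Finset.sum_congr rfl fun k hk => ?_
        obtain ⟨j, hj⟩ := Nat.exists_eq_add_of_le (Finset.mem_range.1 hk).le
        rw [Polynomial.eval_monomial, drawProb, div_pow, show m - k = j by omega,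
          show ((T - (i : ℕ) : ℕ) : ℝ) ^ m = (T - (i : ℕ) : ℕ) ^ k * (T - (i : ℕ) : ℕ) ^ j by
            rw [← pow_add, ← hj]]
        field_simp
      rw [mul_zero] at h2
      exact (mul_eq_zero.1 h2).resolve_right (pow_ne_zero _ hb)
    have hq0 : q = 0 := by
      refine Polynomial.eq_zero_of_natDegree_lt_card_of_eval_eq_zero q
        (f := fun i : Fin m => ((i : ℕ) : ℝ) / (T - (i : ℕ) : ℕ)) ?_ heval ?_
      · intro i j hij
        have hbi : ((T - (i : ℕ) : ℕ) : ℝ) ≠ 0 := by exact_mod_cast (by omega : T - (i : ℕ) ≠ 0)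
        have hbj : ((T - (j : ℕ) : ℕ) : ℝ) ≠ 0 := by exact_mod_cast (by omega : T - (j : ℕ) ≠ 0)
        have hT0 : (T : ℝ) ≠ 0 := by exact_mod_cast (by omega : T ≠ 0)
        simp only at hij
        rw [div_eq_div_iff hbi hbj, Nat.cast_sub (by omega), Nat.cast_sub (by omega)] at hij
        refine Fin.ext ?_
        have : (T : ℝ) * (i : ℕ) = T * (j : ℕ) := by linarith
        exact_mod_cast mul_left_cancel₀ hT0 this
      · rw [Fintype.card_fin]
        refine Nat.lt_of_le_pred hm (Polynomial.natDegree_sum_le_of_forall_le _ _ fun k hk =>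
          (Polynomial.natDegree_monomial_le _).trans ?_)
        exact Nat.le_pred_of_lt (Finset.mem_range.1 hk)
    intro k hk
    rcases hk.eq_or_lt with rfl | hk
    · exact hdm
    have h := congrArg (fun p => Polynomial.coeff p k) hq0
    simp only [hq, Polynomial.finsetSum_coeff, Polynomial.coeff_monomial, Polynomial.coeff_zero,
      Finset.sum_ite_eq', Finset.mem_range, hk, if_true] at h
    refine (mul_eq_zero.1 h).resolve_left ?_
    exact_mod_cast (Nat.choose_pos hk.le).ne'

end SamplingModel

namespace BalancedUrn

variable {U : BalancedUrn} {S : SamplingModel}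

lemma total_pos (U : BalancedUrn) (n : ℕ) : 0 < U.total n := by
  have h1 := U.m_le_initial
  have h2 := U.one_le_m
  unfold total
  omega

lemma m_le_total (U : BalancedUrn) (n : ℕ) : U.m ≤ U.total n :=
  U.m_le_initial.trans (Nat.le_add_right _ _)

/-- Affinity at the first draw alone suffices. Because `k` has mean `m w / T_0`, the affine function
`B + A T_0 / m * k` has the same mean `A w + B` as `a (m - k)` under every composition of `T_0`
balls, so the two agree by separation. -/
lemma IsAffine.a_eq (haff : U.IsAffine S) (k : ℕ) (hk : k ≤ U.m) :
    (U.a (U.m - k) : ℝ) = U.a U.m + ((U.a (U.m - 1) : ℝ) - U.a U.m) * k := by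
  obtain ⟨α, β, h⟩ := haff
  have hT0 : (0 : ℝ) < U.total 0 := by exact_mod_cast U.total_pos 0
  have hm0 : (0 : ℝ) < U.m := by exact_mod_cast U.one_le_m
  obtain ⟨A, B, hAB⟩ : ∃ A B : ℝ, ∀ w b : ℕ, w + b = U.total 0 →
      ∑ k ∈ Finset.range (U.m + 1), S.drawProb U.m w b k * (U.a (U.m - k) : ℝ) = A * w + B :=
    ⟨α 1 - 1, β 1, fun w b hwb => by linarith [h 0 w b hwb]⟩
  have hz := S.eq_zero_of_sum_drawProb_mul_eq_zero U.one_le_m (U.m_le_total 0)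
    (fun k => (U.a (U.m - k) : ℝ) - (B + A * U.total 0 / U.m * k)) (by
      intro w b hwb
      have h0 : 0 < w + b := hwb ▸ U.total_pos 0
      have h1 : U.m ≤ w + b := hwb ▸ U.m_le_total 0
      have h2 : (w : ℝ) + b = U.total 0 := by exact_mod_cast hwb
      simp only [mul_sub, mul_add, Finset.sum_sub_distrib, Finset.sum_add_distrib]
      rw [hAB w b hwb, ← Finset.sum_mul, S.sum_drawProb h1 h0]
      have := S.sum_mul_drawProb h1 h0
      rw [Finset.sum_congr rfl fun k _ => show S.drawProb U.m w b k * (A * U.total 0 / U.m * k)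
        = A * U.total 0 / U.m * (k * S.drawProb U.m w b k) by ring, ← Finset.mul_sum, this, h2]
      field_simp
      ring)
  have e0 := hz 0 (Nat.zero_le _)
  have e1 := hz 1 U.one_le_m
  have ek := hz k hk
  simp only [Nat.sub_zero, Nat.cast_zero, Nat.cast_one] at e0 e1 ek
  rw [show (U.a (U.m - 1) : ℝ) - U.a U.m = A * U.total 0 / U.m by linarith]
  linarith

end BalancedUrn

/-! ### Tenability and the signs of the replacement numbers. -/

namespace SamplingModel

lemma drawProb_zero_pos (S : SamplingModel) {m w b : ℕ} (hm : 1 ≤ m) (hb : m ≤ b) :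
    0 < S.drawProb m w b 0 := by
  cases S with
  | withoutReplacement =>
    have h1 : 0 < b.choose m := Nat.choose_pos hb
    have h2 : 0 < (w + b).choose m := Nat.choose_pos (by omega)
    simp only [drawProb, Nat.choose_zero_right, Nat.sub_zero]
    positivity
  | withReplacement =>
    have h1 : 0 < b := by omega
    simp only [drawProb, Nat.choose_zero_right, Nat.sub_zero]
    positivity

lemma drawProb_swap (S : SamplingModel) {m w b k : ℕ} (hk : k ≤ m) :
    S.drawProb m w b k = S.drawProb m b w (m - k) := by
  cases S with
  | withoutReplacement => simp only [drawProb, Nat.sub_sub_self hk, add_comm b w, mul_comm]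
  | withReplacement =>
    simp only [drawProb, Nat.sub_sub_self hk, Nat.choose_symm hk, add_comm (b : ℝ) w]
    ring

end SamplingModel

namespace BalancedUrn

/-- The urn with the two colors exchanged. -/
def swap (U : BalancedUrn) : BalancedUrn where
  m := U.m
  σ := U.σ
  W0 := U.B0
  B0 := U.W0
  a k := U.b (U.m - k)
  b k := U.a (U.m - k)
  one_le_m := U.one_le_m
  one_le_σ := U.one_le_σ
  balanced k _ := by rw [add_comm]; exact U.balanced _ (Nat.sub_le _ _)
  m_le_initial := by rw [add_comm]; exact U.m_le_initial

variable {U : BalancedUrn} {S : SamplingModel}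

lemma Reachable.of_swap {w b : ℤ} (h : U.swap.Reachable S w b) : U.Reachable S b w := by
  induction h with
  | start => exact Reachable.start
  | step w b k _ hk hp ih =>
    have hk' : k ≤ U.m := hk
    have := Reachable.step b w (U.m - k) ih (Nat.sub_le _ _)
      (by rwa [← S.drawProb_swap hk'])
    exact this

lemma IsTenable.swap (h : U.IsTenable S) : U.swap.IsTenable S :=
  fun w b hr => (h b w hr.of_swap).symm

lemma total_succ (U : BalancedUrn) (n : ℕ) : U.total (n + 1) = U.total n + U.σ := by
  unfold total; ring

lemma IsTenable.exists_reachable (h : U.IsTenable S) (n : ℕ) :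
    ∃ w b : ℕ, U.Reachable S w b ∧ w + b = U.total n := by
  induction n with
  | zero => exact ⟨U.W0, U.B0, Reachable.start, by simp [total]⟩
  | succ n ih =>
    obtain ⟨w, b, hr, hwb⟩ := ih
    have hs := S.sum_drawProb (hwb ▸ U.m_le_total n) (hwb ▸ U.total_pos n)
    obtain ⟨k, hk, hp⟩ := Finset.exists_lt_of_sum_lt
      (s := Finset.range (U.m + 1)) (f := fun _ => (0 : ℝ)) (by rw [hs]; simp)
    have hk' : k ≤ U.m := Nat.lt_succ_iff.1 (Finset.mem_range.1 hk)
    have hr' := Reachable.step w b k hr hk' hp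
    obtain ⟨h1, h2⟩ := h _ _ hr'
    refine ⟨((w : ℤ) + U.a (U.m - k)).toNat, ((b : ℤ) + U.b (U.m - k)).toNat, ?_, ?_⟩
    · rwa [Int.toNat_of_nonneg h1, Int.toNat_of_nonneg h2]
    · have := U.balanced (U.m - k) (Nat.sub_le _ _)
      have := U.total_succ n
      omega

/-- Suppose `a_m < 0`. Once there are `m` black balls, all-black samples can be drawn forever, since
they add black balls, and white runs out; so black always stays below `m`. White is then eventually
plentiful, and repeated all-white samples move black steadily by `b_0 ≠ 0`, out of the range from 0
to `m`. -/
lemma IsTenable.a_nonneg (h : U.IsTenable S) (hb : U.b 0 ≠ 0) : 0 ≤ U.a U.m := by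
  by_contra! ha
  have hbal := U.balanced U.m le_rfl
  have hbal0 := U.balanced 0 (Nat.zero_le _)
  have hlt : ∀ w b : ℕ, U.Reachable S w b → b < U.m := by
    intro w b hr
    by_contra! hmb
    have key : ∀ j : ℕ, U.Reachable S (w + j * U.a U.m) (b + j * U.b U.m) := by
      intro j
      induction j with
      | zero => simpa using hr
      | succ j ih =>
        obtain ⟨h1, h2⟩ := h _ _ ih
        obtain ⟨w', hw'⟩ := Int.eq_ofNat_of_zero_le h1
        obtain ⟨b', hb'⟩ := Int.eq_ofNat_of_zero_le h2
        rw [hw', hb'] at ih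
        have hbb : U.m ≤ b' := by
          have : (0 : ℤ) ≤ j * U.b U.m := mul_nonneg (by positivity) (by omega)
          omega
        have := Reachable.step w' b' 0 ih (Nat.zero_le _) (S.drawProb_zero_pos U.one_le_m hbb)
        rw [← hw', ← hb', Nat.sub_zero] at this
        convert this using 1 <;> push_cast <;> ring
    have := (h _ _ (key (w + 1))).1
    have : (((w + 1 : ℕ) : ℤ)) * U.a U.m ≤ ((w + 1 : ℕ) : ℤ) * (-1) :=
      mul_le_mul_of_nonneg_left (by omega) (by positivity)
    push_cast at *
    omega
  -- After `m` draws the total is at least `2 m`, so fewer than `m` black balls leave at least `m`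
  -- white ones and an all-white sample is possible.
  obtain ⟨w, b, hr, hwb⟩ := h.exists_reachable U.m
  have key : ∀ j : ℕ, ∃ w' b' : ℕ, U.Reachable S w' b' ∧ w' + b' = U.total (U.m + j) ∧
      (b' : ℤ) = b + j * U.b 0 := by
    intro j
    induction j with
    | zero => exact ⟨w, b, hr, hwb, by simp⟩
    | succ j ih =>
      obtain ⟨w', b', hr', hwb', hb'⟩ := ih
      have hbm := hlt _ _ hr'
      have hw' : U.m ≤ w' := by
        have h1 : U.m * 1 ≤ U.σ * (U.m + j) := by
          rw [mul_comm U.σ]; exact Nat.mul_le_mul (Nat.le_add_right _ _) U.one_le_σ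
        have h2 := U.m_le_initial
        unfold total at hwb'
        omega
      have hp : 0 < S.drawProb U.m w' b' U.m := by
        rw [S.drawProb_swap le_rfl, Nat.sub_self]
        exact S.drawProb_zero_pos U.one_le_m hw'
      have hs := Reachable.step w' b' U.m hr' le_rfl hp
      rw [Nat.sub_self] at hs
      obtain ⟨h1, h2⟩ := h _ _ hs
      refine ⟨((w' : ℤ) + U.a 0).toNat, ((b' : ℤ) + U.b 0).toNat, ?_, ?_, ?_⟩
      · rwa [Int.toNat_of_nonneg h1, Int.toNat_of_nonneg h2]
      · have := U.total_succ (U.m + j)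
        rw [← add_assoc]
        omega
      · rw [Int.toNat_of_nonneg h2, hb']
        push_cast; ring
  -- After `b + m` steps, each of size at least one, black is negative or at least `m`, according to
  -- the sign of `b_0`.
  obtain ⟨w', b', hr', -, hb'⟩ := key (b + U.m)
  have hbm := hlt _ _ hr'
  rcases lt_or_gt_of_ne hb with h0 | h0
  · have : (((b + U.m : ℕ) : ℤ)) * U.b 0 ≤ ((b + U.m : ℕ) : ℤ) * (-1) :=
      mul_le_mul_of_nonneg_left (by omega) (by positivity)
    have := U.one_le_m
    push_cast at *
    omega
  · have : (((b + U.m : ℕ) : ℤ)) * 1 ≤ ((b + U.m : ℕ) : ℤ) * U.b 0 :=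
      mul_le_mul_of_nonneg_left (by omega) (by positivity)
    push_cast at *
    omega

lemma IsTenable.pos_and_pos (h : U.IsTenable S) (ha : U.a U.m ≠ 0) (hb : U.b 0 ≠ 0) :
    0 < U.a U.m ∧ 0 < U.b 0 := by
  refine ⟨lt_of_le_of_ne (h.a_nonneg hb) ha.symm, lt_of_le_of_ne ?_ hb.symm⟩
  have := h.swap.a_nonneg (by simpa [BalancedUrn.swap] using ha)
  simpa [BalancedUrn.swap] using this

end BalancedUrn

/-! ### Variance of one sample. -/

namespace SamplingModel

/-- The variance of the number of white balls in a sample. -/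
noncomputable def drawVar (S : SamplingModel) (m w b : ℕ) : ℝ :=
  ∑ k ∈ Finset.range (m + 1), ((k : ℝ) - m * (w / ((w : ℝ) + b))) ^ 2 * S.drawProb m w b k

lemma drawVar_nonneg (S : SamplingModel) (m w b : ℕ) : 0 ≤ S.drawVar m w b :=
  Finset.sum_nonneg fun _ _ => mul_nonneg (sq_nonneg _) (S.drawProb_nonneg _ _ _ _)

/-- The parallel axis identity. The center `c = 0` suits bounds by the white proportion, `c = m`
those by the black one. -/
lemma drawVar_eq (S : SamplingModel) {m w b : ℕ} (hT : m ≤ w + b) (hT0 : 0 < w + b) (c : ℝ) :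
    S.drawVar m w b = ∑ k ∈ Finset.range (m + 1), ((k : ℝ) - c) ^ 2 * S.drawProb m w b k
      - (m * (w / ((w : ℝ) + b)) - c) ^ 2 := by
  have h0 := S.sum_drawProb hT hT0
  have h1 := S.sum_mul_drawProb hT hT0
  set p : ℝ := w / ((w : ℝ) + b) with hp
  have key : ∀ d : ℝ, ∑ k ∈ Finset.range (m + 1), ((k : ℝ) - d) ^ 2 * S.drawProb m w b k
      = ∑ k ∈ Finset.range (m + 1), (k : ℝ) ^ 2 * S.drawProb m w b k - 2 * d * (m * p) + d ^ 2 := by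
    intro d
    rw [← h1, Finset.mul_sum, ← mul_one (d ^ 2), ← h0, Finset.mul_sum, ← Finset.sum_sub_distrib,
      ← Finset.sum_add_distrib]
    exact Finset.sum_congr rfl fun k _ => by ring
  rw [drawVar, key, key]
  ring

lemma abs_drawVar_sub_le (S : SamplingModel) {m w b : ℕ} (hT : m ≤ w + b) (hT0 : 0 < w + b) :
    |S.drawVar m w b - m * (w / ((w : ℝ) + b)) * (1 - w / ((w : ℝ) + b))|
      ≤ m ^ 2 / ((w : ℝ) + b) := by
  refine le_trans (le_of_eq ?_) (S.sum_sq_mul_drawProb hT hT0)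
  rw [S.drawVar_eq hT hT0 0]
  simp only [sub_zero]
  congr 1
  ring

/-- From `k ^ 2 ≤ m k`. This gain over the trivial bound `m ^ 2` is what makes triangular urns
converge for every positive index. -/
lemma drawVar_le_left (S : SamplingModel) {m w b : ℕ} (hT : m ≤ w + b) (hT0 : 0 < w + b) :
    S.drawVar m w b ≤ m ^ 2 * (w / ((w : ℝ) + b)) := by
  rw [S.drawVar_eq hT hT0 0]
  have h1 := S.sum_mul_drawProb hT hT0
  have h2 : ∑ k ∈ Finset.range (m + 1), ((k : ℝ) - 0) ^ 2 * S.drawProb m w b k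
      ≤ m * ∑ k ∈ Finset.range (m + 1), (k : ℝ) * S.drawProb m w b k := by
    rw [Finset.mul_sum]
    refine Finset.sum_le_sum fun k hk => ?_
    have hk' : (k : ℝ) ≤ m := by exact_mod_cast Nat.lt_succ_iff.1 (Finset.mem_range.1 hk)
    rw [sub_zero, sq, mul_assoc]
    exact mul_le_mul_of_nonneg_right hk' (mul_nonneg (by positivity) (S.drawProb_nonneg _ _ _ _))
  rw [h1] at h2
  nlinarith [sq_nonneg ((m : ℝ) * (w / ((w : ℝ) + b)) - 0)]

lemma drawVar_le_right (S : SamplingModel) {m w b : ℕ} (hT : m ≤ w + b) (hT0 : 0 < w + b) :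
    S.drawVar m w b ≤ m ^ 2 * (b / ((w : ℝ) + b)) := by
  have hT0' : (0 : ℝ) < (w : ℝ) + b := by exact_mod_cast hT0
  rw [S.drawVar_eq hT hT0 m]
  have h0 := S.sum_drawProb hT hT0
  have h1 := S.sum_mul_drawProb hT hT0
  have h2 : ∑ k ∈ Finset.range (m + 1), ((k : ℝ) - m) ^ 2 * S.drawProb m w b k
      ≤ m * (m * 1 - ∑ k ∈ Finset.range (m + 1), (k : ℝ) * S.drawProb m w b k) := by
    rw [← h0, Finset.mul_sum, ← Finset.sum_sub_distrib, Finset.mul_sum]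
    refine Finset.sum_le_sum fun k hk => ?_
    have hk' : (k : ℝ) ≤ m := by exact_mod_cast Nat.lt_succ_iff.1 (Finset.mem_range.1 hk)
    rw [← sub_mul, ← mul_assoc]
    refine mul_le_mul_of_nonneg_right ?_ (S.drawProb_nonneg _ _ _ _)
    nlinarith [(Nat.cast_nonneg k : (0 : ℝ) ≤ k)]
  rw [h1] at h2
  have h3 : (b : ℝ) / (w + b) = 1 - w / (w + b) := by field_simp; ring
  rw [h3]
  nlinarith [sq_nonneg ((m : ℝ) * (w / ((w : ℝ) + b)) - m)]

end SamplingModel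

/-- A process `Y` that is bounded at each time and adapted, with `E[Y (n+1) | ℱ n] = g n * Y n`,
whose innovations are bounded by `C` and have conditional variance `q n`. -/
structure IsLinearRecursion {Ω : Type*} [mΩ : MeasurableSpace Ω] (P : Measure Ω)
    (ℱ : Filtration ℕ mΩ) (g : ℕ → ℝ) (C : ℝ) (Y q : ℕ → Ω → ℝ) : Prop where
  stronglyMeasurable : ∀ n, StronglyMeasurable[ℱ n] (Y n)
  stronglyMeasurable_var : ∀ n, StronglyMeasurable[ℱ n] (q n)
  bounded : ∀ n, ∃ B, ∀ ω, |Y n ω| ≤ B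
  step_le : ∀ n, ∀ᵐ ω ∂P, |Y (n + 1) ω - g n * Y n ω| ≤ C
  var_nonneg : ∀ n ω, 0 ≤ q n ω
  var_le : ∀ n, ∀ᵐ ω ∂P, q n ω ≤ C ^ 2
  integral_mul_step : ∀ (n : ℕ) (Z : Ω → ℝ), StronglyMeasurable[ℱ n] Z → (∃ B, ∀ ω, |Z ω| ≤ B) →
    ∫ ω, Z ω * (Y (n + 1) ω - g n * Y n ω) ∂P = 0
  integral_mul_step_sq : ∀ (n : ℕ) (Z : Ω → ℝ), StronglyMeasurable[ℱ n] Z →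
    (∃ B, ∀ ω, |Z ω| ≤ B) →
    ∫ ω, Z ω * (Y (n + 1) ω - g n * Y n ω) ^ 2 ∂P = ∫ ω, Z ω * q n ω ∂P

lemma IsLinearRecursion.neg {Ω : Type*} [mΩ : MeasurableSpace Ω] {P : Measure Ω}
    {ℱ : Filtration ℕ mΩ} {g : ℕ → ℝ} {C : ℝ} {Y q : ℕ → Ω → ℝ}
    (h : IsLinearRecursion P ℱ g C Y q) :
    IsLinearRecursion P ℱ g C (fun n ω => - Y n ω) q := by
  have e : ∀ n ω, - Y (n + 1) ω - g n * - Y n ω = - (Y (n + 1) ω - g n * Y n ω) := by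
    intros; ring
  refine ⟨fun n => (h.stronglyMeasurable n).neg, h.stronglyMeasurable_var, fun n => ?_,
    fun n => ?_, h.var_nonneg, h.var_le, fun n Z hZ hB => ?_, fun n Z hZ hB => ?_⟩
  · simpa only [abs_neg] using h.bounded n
  · simpa only [e, abs_neg] using h.step_le n
  · simp only [e]
    simp only [mul_neg, integral_neg, h.integral_mul_step n Z hZ hB, neg_zero]
  · simpa only [e, neg_sq] using h.integral_mul_step_sq n Z hZ hB

/-! ### The urn process as a linear recursion. -/

namespace BalancedUrn

variable {U : BalancedUrn} {S : SamplingModel} {Ω : Type*}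

lemma white_add_black (K : ℕ → Ω → Fin (U.m + 1)) (n : ℕ) (ω : Ω) :
    U.white K n ω + U.black K n ω = U.total n := by
  have : ∀ i, U.a (U.m - (K i ω : ℕ)) + U.b (U.m - (K i ω : ℕ)) = U.σ :=
    fun i => U.balanced _ (Nat.sub_le _ _)
  unfold white black total
  rw [add_add_add_comm, ← Finset.sum_add_distrib]
  simp only [this, Finset.sum_const, Finset.card_range]
  push_cast
  ring

lemma white_succ (K : ℕ → Ω → Fin (U.m + 1)) (n : ℕ) (ω : Ω) :
    U.white K (n + 1) ω = U.white K n ω + U.a (U.m - (K n ω : ℕ)) := by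
  simp [white, Finset.sum_range_succ, add_assoc]

lemma black_succ (K : ℕ → Ω → Fin (U.m + 1)) (n : ℕ) (ω : Ω) :
    U.black K (n + 1) ω = U.black K n ω + U.b (U.m - (K n ω : ℕ)) := by
  simp [black, Finset.sum_range_succ, add_assoc]

lemma exists_abs_white_le (U : BalancedUrn) (K : ℕ → Ω → Fin (U.m + 1)) (n : ℕ) :
    ∃ B : ℝ, ∀ ω, |(U.white K n ω : ℝ)| ≤ B := by
  refine ⟨U.W0 + ∑ i ∈ Finset.range n, ∑ k : Fin (U.m + 1), |(U.a (U.m - k) : ℝ)|, fun ω => ?_⟩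
  unfold white
  push_cast
  refine (abs_add_le _ _).trans (add_le_add (by simp) ?_)
  refine (Finset.abs_sum_le_sum_abs _ _).trans (Finset.sum_le_sum fun i _ => ?_)
  exact Finset.single_le_sum (f := fun k : Fin (U.m + 1) => |(U.a (U.m - k) : ℝ)|)
    (fun _ _ => abs_nonneg _) (Finset.mem_univ (K i ω))

lemma measurable_draw (U : BalancedUrn) (K : ℕ → Ω → Fin (U.m + 1)) {i n : ℕ} (hi : i < n) :
    Measurable[U.drawSigma K n] (K i) :=
  (comap_measurable (K i)).mono
    (le_iSup₂_of_le (f := fun i (_ : i ∈ Finset.range n) =>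
      MeasurableSpace.comap (K i) inferInstance) i (Finset.mem_range.2 hi) le_rfl) le_rfl

lemma measurable_white (U : BalancedUrn) (K : ℕ → Ω → Fin (U.m + 1)) (n : ℕ) :
    Measurable[U.drawSigma K n] (U.white K n) := by
  let _ : MeasurableSpace Ω := U.drawSigma K n
  unfold white
  refine Measurable.const_add (Finset.measurable_fun_sum _ fun i hi => ?_) _
  exact (measurable_of_finite (fun k : Fin (U.m + 1) => U.a (U.m - (k : ℕ)))).comp
    (U.measurable_draw K (Finset.mem_range.1 hi))

lemma measurable_comp_white_black {β : Type*} [MeasurableSpace β] (U : BalancedUrn)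
    (K : ℕ → Ω → Fin (U.m + 1)) (f : ℤ → ℤ → β) (n : ℕ) :
    Measurable[U.drawSigma K n] (fun ω => f (U.white K n ω) (U.black K n ω)) := by
  have h : ∀ ω, U.black K n ω = U.total n - U.white K n ω := fun ω => by
    rw [← U.white_add_black K n ω]; ring
  simp only [h]
  exact (Measurable.of_discrete (f := fun z : ℤ => f z (U.total n - z))).comp
    (U.measurable_white K n)

variable [mΩ : MeasurableSpace Ω] {P : Measure Ω} {K : ℕ → Ω → Fin (U.m + 1)}

/-- The filtration generated by the draws. -/
def drawFiltration (U : BalancedUrn) (K : ℕ → Ω → Fin (U.m + 1)) (hK : ∀ n, Measurable (K n)) :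
    Filtration ℕ mΩ where
  seq n := U.drawSigma K n
  mono' _ _ hij := biSup_mono fun _ hi => Finset.range_mono hij hi
  le' _ := iSup₂_le fun i _ => (hK i).comap_le

/-- Decompose over the value of the draw and pull the factor `F k`, known at time `n`, out of the
conditional expectation. All later information on the law of the draws enters through this formula.
-/
lemma IsDrawSequence.integral_eq [IsProbabilityMeasure P] (hK : U.IsDrawSequence S P K) (n : ℕ)
    (F : Fin (U.m + 1) → Ω → ℝ) (hF : ∀ k, StronglyMeasurable[U.drawSigma K n] (F k))
    (hB : ∀ k, ∃ B, ∀ ω, |F k ω| ≤ B) :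
    ∫ ω, F (K n ω) ω ∂P = ∫ ω, ∑ k : Fin (U.m + 1),
      F k ω * S.drawProb U.m (U.white K n ω).toNat (U.black K n ω).toNat (k : ℕ) ∂P := by
  have hle : U.drawSigma K n ≤ mΩ := (U.drawFiltration K hK.measurable).le n
  have hset : ∀ k, MeasurableSet (K n ⁻¹' {k}) := fun k =>
    hK.measurable n (measurableSet_singleton k)
  have hind : ∀ k, Integrable ((K n ⁻¹' {k}).indicator fun _ => (1 : ℝ)) P := fun k =>
    (integrable_const 1).indicator (hset k)
  have hint : ∀ k (f : Ω → ℝ), Integrable f P → Integrable (fun ω => F k ω * f ω) P := by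
    intro k f hf
    obtain ⟨B, hB⟩ := hB k
    exact hf.bdd_mul ((hF k).mono hle).aestronglyMeasurable (Eventually.of_forall hB)
  have hsum : ∀ ω, F (K n ω) ω
      = ∑ k, F k ω * (K n ⁻¹' {k}).indicator (fun _ => (1 : ℝ)) ω := by
    intro ω
    rw [Finset.sum_eq_single (K n ω)]
    · simp
    · intro k _ hk
      simp [Set.indicator, hk.symm]
    · simp
  simp only [hsum]
  have hp : ∀ k : Fin (U.m + 1), Integrable (fun ω =>
      S.drawProb U.m (U.white K n ω).toNat (U.black K n ω).toNat (k : ℕ)) P := fun k =>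
    (integrable_congr (hK.condProb n k)).1 integrable_condExp
  rw [integral_finsetSum _ fun k _ => hint k _ (hind k),
    integral_finsetSum _ fun k _ => hint k _ (hp k)]
  refine Finset.sum_congr rfl fun k _ => ?_
  rw [← integral_condExp hle]
  refine integral_congr_ae ?_
  refine (condExp_mul_of_stronglyMeasurable_left (hF k) (hint k _ (hind k)) (hind k)).trans ?_
  filter_upwards [hK.condProb n k] with ω hω
  simp only [Pi.mul_apply]
  congr 1

lemma IsDrawSequence.ae_drawProb_pos [IsProbabilityMeasure P] (hK : U.IsDrawSequence S P K)
    (n : ℕ) : ∀ᵐ ω ∂P,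
      0 < S.drawProb U.m (U.white K n ω).toNat (U.black K n ω).toNat (K n ω : ℕ) := by
  classical
  obtain ⟨f, hf⟩ : ∃ f : (ℤ × ℤ) × Fin (U.m + 1) → ℝ, ∀ w b k,
    f ((w, b), k) = S.drawProb U.m w.toNat b.toNat (k : ℕ) := 
    ⟨fun x => S.drawProb U.m x.1.1.toNat x.1.2.toNat (x.2 : ℕ), fun _ _ _ => rfl⟩
  have hf0 : ∀ w b k, 0 ≤ f ((w, b), k) := fun w b k => by
    rw [hf]; exact S.drawProb_nonneg _ _ _ _
  -- The test function is the indicator that the drawn value has probability zero; weighted by that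
  -- probability, it vanishes identically.
  have h := hK.integral_eq n
    (fun k ω => if 0 < f ((U.white K n ω, U.black K n ω), k) then 0 else 1)
    (fun k => (U.measurable_comp_white_black K
      (fun w b => if 0 < f ((w, b), k) then (0 : ℝ) else 1) n).stronglyMeasurable)
    (fun k => ⟨1, fun ω => by split_ifs <;> simp⟩)
  simp only [← hf] at h ⊢
  have h0 : ∀ ω, ∑ k : Fin (U.m + 1),
      (if 0 < f ((U.white K n ω, U.black K n ω), k) then (0 : ℝ) else 1)
        * f ((U.white K n ω, U.black K n ω), k) = 0 := by
    intro ω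
    refine Finset.sum_eq_zero fun k _ => ?_
    split_ifs with hk
    · simp
    · rw [le_antisymm (not_lt.1 hk) (hf0 _ _ _), mul_zero]
  simp only [h0, integral_zero] at h
  have hle : U.drawSigma K n ≤ mΩ := (U.drawFiltration K hK.measurable).le n
  have hm : Measurable (fun ω => f ((U.white K n ω, U.black K n ω), K n ω)) :=
    (Measurable.of_discrete (f := f)).comp
      (((U.measurable_comp_white_black K Prod.mk n).mono hle le_rfl).prodMk (hK.measurable n))
  have h1 : Integrable (fun ω => if 0 < f ((U.white K n ω, U.black K n ω), K n ω)
      then (0 : ℝ) else 1) P :=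
    Integrable.of_bound (C := 1) (Measurable.aestronglyMeasurable
      (Measurable.ite (measurableSet_lt measurable_const hm) measurable_const measurable_const))
      (Eventually.of_forall fun ω => by split_ifs <;> simp)
  filter_upwards [(integral_eq_zero_iff_of_nonneg
    (fun ω => by dsimp only; split_ifs <;> simp) h1).1 h] with ω hω
  by_contra hc
  simp [hc] at hω

lemma IsDrawSequence.ae_reachable [IsProbabilityMeasure P] (hK : U.IsDrawSequence S P K)
    (hten : U.IsTenable S) (n : ℕ) :
    ∀ᵐ ω ∂P, U.Reachable S (U.white K n ω) (U.black K n ω) := by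
  induction n with
  | zero =>
    refine Eventually.of_forall fun ω => ?_
    simpa [white, black] using Reachable.start
  | succ n ih =>
    filter_upwards [ih, hK.ae_drawProb_pos n] with ω hr hp
    obtain ⟨h1, h2⟩ := hten _ _ hr
    rw [white_succ, black_succ]
    have := Reachable.step (S := S) (U.white K n ω).toNat (U.black K n ω).toNat (K n ω)
      (by rwa [Int.toNat_of_nonneg h1, Int.toNat_of_nonneg h2]) (Nat.lt_succ_iff.1 (K n ω).2) hp
    rwa [Int.toNat_of_nonneg h1, Int.toNat_of_nonneg h2] at this

lemma IsDrawSequence.ae_exists_nat [IsProbabilityMeasure P] (hK : U.IsDrawSequence S P K)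
    (hten : U.IsTenable S) (n : ℕ) :
    ∀ᵐ ω ∂P, ∃ w b : ℕ, U.white K n ω = w ∧ U.black K n ω = b ∧ w + b = U.total n := by
  filter_upwards [hK.ae_reachable hten n] with ω hr
  obtain ⟨h1, h2⟩ := hten _ _ hr
  refine ⟨(U.white K n ω).toNat, (U.black K n ω).toNat, (Int.toNat_of_nonneg h1).symm,
    (Int.toNat_of_nonneg h2).symm, ?_⟩
  have := U.white_add_black K n ω
  omega

/-- The slope of the affine replacement rule. -/
def slope (U : BalancedUrn) : ℝ := (U.a (U.m - 1) : ℝ) - U.a U.m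

/-- The conditional variance of the increment of the number of white balls. -/
noncomputable def stepVar (U : BalancedUrn) (S : SamplingModel) (K : ℕ → Ω → Fin (U.m + 1)) (n : ℕ)
    (ω : Ω) : ℝ :=
  U.slope ^ 2 * S.drawVar U.m (U.white K n ω).toNat (U.black K n ω).toNat

/-- The growth factor of the mean. -/
noncomputable def growth (U : BalancedUrn) (n : ℕ) : ℝ := 1 + U.m * U.slope / U.total n

/-- Leaving the solution `c` of the mean recursion free serves several purposes: the mean centers
the process, `c = 0` and `c = T_n` treat the two triangular cases, and a multiple of `T_n` controls
the proportion of white balls. -/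
lemma IsDrawSequence.isLinearRecursion [IsProbabilityMeasure P] (hK : U.IsDrawSequence S P K)
    (hten : U.IsTenable S) (haff : U.IsAffine S) (c : ℕ → ℝ)
    (hc : ∀ n, c (n + 1) = U.growth n * c n + U.a U.m) :
    IsLinearRecursion P (U.drawFiltration K hK.measurable) U.growth (|U.slope| * U.m)
      (fun n ω => (U.white K n ω : ℝ) - c n) (U.stepVar S K) := by
  -- The innovation is the slope times the deviation of the sample from its conditional mean; `c`
  -- drops out.
  have hstep : ∀ n ω, ((U.white K (n + 1) ω : ℝ) - c (n + 1)) - U.growth n *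
      ((U.white K n ω : ℝ) - c n)
      = U.slope * ((K n ω : ℕ) - U.m * ((U.white K n ω : ℝ) / U.total n)) := by
    intro n ω
    have ha := haff.a_eq (K n ω) (Nat.lt_succ_iff.1 (K n ω).2)
    rw [white_succ, hc]
    push_cast
    rw [ha, growth, slope]
    ring
  have hmW : ∀ n, StronglyMeasurable[U.drawSigma K n] fun ω => (U.white K n ω : ℝ) := fun n =>
    (U.measurable_comp_white_black K (fun w _ => (w : ℝ)) n).stronglyMeasurable
  have habs : ∀ (n : ℕ) (k : ℕ) (w b : ℕ), k ≤ U.m → w + b = U.total n →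
      |(k : ℝ) - U.m * ((w : ℝ) / U.total n)| ≤ U.m := by
    intro n k w b hk hwb
    have hT : (0 : ℝ) < U.total n := by exact_mod_cast U.total_pos n
    have h1 : (w : ℝ) / U.total n ≤ 1 := by
      rw [div_le_one hT]; exact_mod_cast (by omega : w ≤ U.total n)
    have h2 : (0 : ℝ) ≤ (w : ℝ) / U.total n := by positivity
    have h3 : (k : ℝ) ≤ U.m := by exact_mod_cast hk
    have h4 : (0 : ℝ) ≤ k := Nat.cast_nonneg k
    rw [abs_le]
    constructor <;> nlinarith
  have hFmeas : ∀ (n : ℕ) (Z : Ω → ℝ), StronglyMeasurable[U.drawSigma K n] Z →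
      ∀ k : Fin (U.m + 1), StronglyMeasurable[U.drawSigma K n] (fun ω => Z ω *
        (U.slope * ((k : ℕ) - U.m * ((U.white K n ω : ℝ) / U.total n)))) := fun n Z hZ k =>
    hZ.mul ((stronglyMeasurable_const.sub (((hmW n).mul_const _).const_mul _)).const_mul _)
  have hbd : ∀ n, ∃ B, ∀ (k : Fin (U.m + 1)) ω,
      |U.slope * ((k : ℕ) - U.m * ((U.white K n ω : ℝ) / U.total n))| ≤ B := by
    intro n
    obtain ⟨B, hB⟩ := U.exists_abs_white_le K n
    refine ⟨|U.slope| * (U.m + U.m * (B / U.total n)), fun k ω => ?_⟩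
    have hk : ((k : ℕ) : ℝ) ≤ U.m := by exact_mod_cast Nat.lt_succ_iff.1 k.2
    rw [abs_mul]
    refine mul_le_mul_of_nonneg_left ((abs_sub _ _).trans (add_le_add ?_ ?_)) (abs_nonneg _)
    · rwa [abs_of_nonneg (Nat.cast_nonneg _)]
    · rw [abs_mul, abs_div, Nat.abs_cast, Nat.abs_cast]
      gcongr
      exact hB ω
  refine ⟨fun n => (hmW n).sub stronglyMeasurable_const,
    fun n => (U.measurable_comp_white_black K (fun w b =>
      U.slope ^ 2 * S.drawVar U.m w.toNat b.toNat) n).stronglyMeasurable, ?_, ?_, ?_, ?_, ?_, ?_⟩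
  · intro n
    obtain ⟨B, hB⟩ := U.exists_abs_white_le K n
    exact ⟨B + |c n|, fun ω => (abs_sub _ _).trans (by gcongr; exact hB ω)⟩
  · intro n
    filter_upwards [hK.ae_exists_nat hten n] with ω ⟨w, b, hw, hb, hwb⟩
    rw [hstep, abs_mul, hw]
    exact mul_le_mul_of_nonneg_left (habs n _ w b (Nat.lt_succ_iff.1 (K n ω).2) hwb) (abs_nonneg _)
  · exact fun n ω => mul_nonneg (sq_nonneg _) (S.drawVar_nonneg _ _ _)
  · intro n
    filter_upwards [hK.ae_exists_nat hten n] with ω ⟨w, b, hw, hb, hwb⟩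
    rw [stepVar, hw, hb, mul_pow, sq_abs]
    refine mul_le_mul_of_nonneg_left ?_ (sq_nonneg _)
    simp only [Int.toNat_natCast]
    have hT0 : 0 < w + b := hwb ▸ U.total_pos n
    refine (S.drawVar_le_left (hwb ▸ U.m_le_total n) hT0).trans ?_
    have hT : (0 : ℝ) < (w : ℝ) + b := by exact_mod_cast hT0
    refine mul_le_of_le_one_right (by positivity) ?_
    rw [div_le_one hT]
    linarith [(Nat.cast_nonneg b : (0 : ℝ) ≤ b)]
  · intro n Z hZ ⟨B, hB⟩
    simp only [hstep]
    obtain ⟨B', hB'⟩ := hbd n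
    rw [hK.integral_eq n (fun k ω => Z ω *
      (U.slope * ((k : ℕ) - U.m * ((U.white K n ω : ℝ) / U.total n)))) (hFmeas n Z hZ)
      (fun k => ⟨B * B', fun ω => by
        rw [abs_mul]
        exact mul_le_mul (hB ω) (hB' k ω) (abs_nonneg _) ((abs_nonneg _).trans (hB ω))⟩)]
    refine integral_eq_zero_of_ae ?_
    filter_upwards [hK.ae_exists_nat hten n] with ω ⟨w, b, hw, hb, hwb⟩
    have h0 := S.sum_drawProb (hwb ▸ U.m_le_total n : U.m ≤ w + b) (hwb ▸ U.total_pos n)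
    have h1 := S.sum_mul_drawProb (hwb ▸ U.m_le_total n : U.m ≤ w + b) (hwb ▸ U.total_pos n)
    have hT : (w : ℝ) + b = U.total n := by exact_mod_cast hwb
    rw [hT] at h1
    simp only [hw, hb, Int.toNat_natCast, Pi.zero_apply, Int.cast_natCast]
    rw [← Finset.sum_range (fun k => Z ω * (U.slope * ((k : ℝ) - U.m * ((w : ℝ) / U.total n)))
      * S.drawProb U.m w b k)]
    calc _ = Z ω * U.slope * (∑ k ∈ Finset.range (U.m + 1), (k : ℝ) * S.drawProb U.m w b k
          - U.m * ((w : ℝ) / U.total n) * ∑ k ∈ Finset.range (U.m + 1), S.drawProb U.m w b k) := by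
          rw [Finset.mul_sum, ← Finset.sum_sub_distrib, Finset.mul_sum]
          exact Finset.sum_congr rfl fun k _ => by ring
      _ = 0 := by rw [h0, h1]; ring
  · intro n Z hZ ⟨B, hB⟩
    simp only [hstep]
    obtain ⟨B', hB'⟩ := hbd n
    rw [hK.integral_eq n (fun k ω => Z ω *
      (U.slope * ((k : ℕ) - U.m * ((U.white K n ω : ℝ) / U.total n))) ^ 2)
      (fun k => hZ.mul ((by simpa using hFmeas n (fun _ => 1) stronglyMeasurable_const k :
        StronglyMeasurable[U.drawSigma K n] _).pow 2))
      (fun k => ⟨B * B' ^ 2, fun ω => by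
        rw [abs_mul, abs_pow]
        have := hB' k ω
        exact mul_le_mul (hB ω) (by gcongr) (by positivity) ((abs_nonneg _).trans (hB ω))⟩)]
    refine integral_congr_ae ?_
    filter_upwards [hK.ae_exists_nat hten n] with ω ⟨w, b, hw, hb, hwb⟩
    have hT : (w : ℝ) + b = U.total n := by exact_mod_cast hwb
    simp only [hw, hb, Int.toNat_natCast, Int.cast_natCast, stepVar, SamplingModel.drawVar, hT]
    rw [← Finset.sum_range (fun k => Z ω * (U.slope * ((k : ℝ) - U.m * ((w : ℝ) / U.total n))) ^ 2
      * S.drawProb U.m w b k), Finset.mul_sum, Finset.mul_sum]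
    exact Finset.sum_congr rfl fun k _ => by ring

end BalancedUrn

/-- The partial products of the growth factors `1 + l / (i + x)`. -/
noncomputable def growthProd (x l : ℝ) (n : ℕ) : ℝ := ∏ i ∈ Finset.range n, (1 + l / (i + x))

/-! ### Asymptotics of the growth products. -/

lemma growthProd_succ (x l : ℝ) (n : ℕ) :
    growthProd x l (n + 1) = growthProd x l n * (1 + l / (n + x)) := Finset.prod_range_succ _ _

lemma one_add_div_pos {x l : ℝ} (hx : 0 < x) (hxl : 0 < x + l) (n : ℕ) :
    0 < 1 + l / (n + x) := by
  have h : (0 : ℝ) < n + x := by positivity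
  have : 1 + l / (n + x) = (n + (x + l)) / (n + x) := by field_simp; ring
  rw [this]
  positivity

lemma growthProd_pos {x l : ℝ} (hx : 0 < x) (hxl : 0 < x + l) (n : ℕ) : 0 < growthProd x l n :=
  Finset.prod_pos fun i _ => one_add_div_pos hx hxl i

/-- Euler's limit formula: `growthProd x l (n + 1) / n ^ l` is the quotient of the Gamma sequences
at `x` and `x + l`. The version with `n + 1` in the power avoids the degenerate value at `n = 0` and
hence gives bounds for all `n`. -/
lemma exists_tendsto_growthProd {x l : ℝ} (hx : 0 < x) (hxl : 0 < x + l) :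
    ∃ c : ℝ, 0 < c ∧ Tendsto (fun n => growthProd x l n / (n : ℝ) ^ l) atTop (𝓝 c) ∧
      Tendsto (fun n => growthProd x l n / ((n : ℝ) + 1) ^ l) atTop (𝓝 c) := by
  refine ⟨Real.Gamma x / Real.Gamma (x + l),
    div_pos (Real.Gamma_pos_of_pos hx) (Real.Gamma_pos_of_pos hxl), ?_⟩
  have h1 : Tendsto (fun n => Real.GammaSeq x n / Real.GammaSeq (x + l) n) atTop
      (𝓝 (Real.Gamma x / Real.Gamma (x + l))) :=
    (Real.GammaSeq_tendsto_Gamma x).div (Real.GammaSeq_tendsto_Gamma _)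
      (Real.Gamma_pos_of_pos hxl).ne'
  have h2 : Tendsto (fun n : ℕ => growthProd x l (n + 1) / (n : ℝ) ^ l) atTop
      (𝓝 (Real.Gamma x / Real.Gamma (x + l))) := by
    refine h1.congr' ?_
    filter_upwards [eventually_gt_atTop 0] with n hn
    have hn' : (0 : ℝ) < n := by exact_mod_cast hn
    have hprod : growthProd x l (n + 1)
        = (∏ j ∈ Finset.range (n + 1), (x + l + j)) / ∏ j ∈ Finset.range (n + 1), (x + j) := by
      rw [growthProd, ← Finset.prod_div_distrib]
      refine Finset.prod_congr rfl fun j _ => ?_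
      have : (0 : ℝ) < j + x := by positivity
      rw [add_comm x (j : ℝ)]
      field_simp
      ring
    have hp1 : 0 < ∏ j ∈ Finset.range (n + 1), (x + (j : ℝ)) :=
      Finset.prod_pos fun j _ => by positivity
    have hp2 : 0 < ∏ j ∈ Finset.range (n + 1), (x + l + (j : ℝ)) :=
      Finset.prod_pos fun j _ => by positivity
    have hf : (0 : ℝ) < n.factorial := by exact_mod_cast n.factorial_pos
    rw [hprod, Real.GammaSeq, Real.GammaSeq, Real.rpow_add hn']
    have h5 : 0 < (n : ℝ) ^ x := Real.rpow_pos_of_pos hn' _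
    have h6 : 0 < (n : ℝ) ^ l := Real.rpow_pos_of_pos hn' _
    field_simp
  have h3 : Tendsto (fun n : ℕ => ((n : ℝ) / (n + 1)) ^ l) atTop (𝓝 1) := by
    have := (tendsto_natCast_div_add_atTop (1 : ℝ)).rpow_const (p := l) (Or.inl one_ne_zero)
    simpa using this
  have h4 : Tendsto (fun n => growthProd x l n / (n : ℝ) ^ l) atTop
      (𝓝 (Real.Gamma x / Real.Gamma (x + l))) := by
    rw [← tendsto_add_atTop_iff_nat 1]
    have := h2.mul h3
    rw [mul_one] at this
    refine this.congr' ?_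
    filter_upwards [eventually_gt_atTop 0] with n hn
    have hn' : (0 : ℝ) < n := by exact_mod_cast hn
    have h6 : 0 < (n : ℝ) ^ l := Real.rpow_pos_of_pos hn' _
    have h7 : 0 < ((n : ℝ) + 1) ^ l := Real.rpow_pos_of_pos (by positivity) _
    rw [Real.div_rpow (by positivity) (by positivity)]
    push_cast
    field_simp
  refine ⟨h4, ?_⟩
  have := h4.mul h3
  rw [mul_one] at this
  refine this.congr' ?_
  filter_upwards [eventually_gt_atTop 0] with n hn
  have hn' : (0 : ℝ) < n := by exact_mod_cast hn
  have h6 : 0 < (n : ℝ) ^ l := Real.rpow_pos_of_pos hn' _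
  have h7 : 0 < ((n : ℝ) + 1) ^ l := Real.rpow_pos_of_pos (by positivity) _
  rw [Real.div_rpow (by positivity) (by positivity)]
  field_simp

lemma exists_growthProd_bounds {x l : ℝ} (hx : 0 < x) (hxl : 0 < x + l) :
    ∃ A B : ℝ, 0 < A ∧ 0 < B ∧ ∀ n : ℕ,
      A * ((n : ℝ) + 1) ^ l ≤ growthProd x l n ∧ growthProd x l n ≤ B * ((n : ℝ) + 1) ^ l := by
  obtain ⟨c, hc, -, h⟩ := exists_tendsto_growthProd hx hxl
  obtain ⟨B, hB⟩ := h.bddAbove_range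
  obtain ⟨A, hA⟩ := (h.inv₀ hc.ne').bddAbove_range
  have hpos : ∀ n : ℕ, 0 < growthProd x l n / ((n : ℝ) + 1) ^ l := fun n =>
    div_pos (growthProd_pos hx hxl n) (Real.rpow_pos_of_pos (by positivity) _)
  have hA0 : 0 < A := (inv_pos.2 (hpos 0)).trans_le (hA ⟨0, rfl⟩)
  have hB0 : 0 < B := (hpos 0).trans_le (hB ⟨0, rfl⟩)
  refine ⟨A⁻¹, B, inv_pos.2 hA0, hB0, fun n => ?_⟩
  have hn : 0 < ((n : ℝ) + 1) ^ l := Real.rpow_pos_of_pos (by positivity) _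
  constructor
  · have h1 := hA ⟨n, rfl⟩
    simp only at h1
    rw [← le_div_iff₀ hn]
    exact inv_le_of_inv_le₀ (hpos n) h1
  · have h1 := hB ⟨n, rfl⟩
    simp only at h1
    rwa [← div_le_iff₀ hn]

/-! ### Moment bounds and almost sure convergence with moments. -/

lemma exists_abs_add_pow_sub_le (n : ℕ) (D : ℝ) : ∃ C, 0 ≤ C ∧ ∀ x d : ℝ, |d| ≤ D →
    |(d + x) ^ (n + 2) - (x ^ (n + 2) + (n + 2) * x ^ (n + 1) * d)| ≤ C * (d ^ 2 * (1 + |x| ^ n)) := by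
  refine ⟨∑ j ∈ Finset.range (n + 1), |D| ^ j * (n + 2).choose (j + 2), by positivity,
    fun x d hd => ?_⟩
  have e : (d + x) ^ (n + 2) - (x ^ (n + 2) + (n + 2) * x ^ (n + 1) * d)
      = ∑ j ∈ Finset.range (n + 1), d ^ (j + 2) * x ^ (n - j) * (n + 2).choose (j + 2) := by
    rw [add_pow, Finset.sum_range_succ', Finset.sum_range_succ']
    simp only [zero_add, pow_zero, pow_one, Nat.choose_zero_right, Nat.choose_one_right,
      Nat.sub_zero, Nat.cast_one]
    rw [show n + 2 - 1 = n + 1 by omega, Finset.sum_congr rfl fun j _ =>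
      show d ^ (j + 1 + 1) * x ^ (n + 2 - (j + 1 + 1)) * ((n + 2).choose (j + 1 + 1) : ℝ)
        = d ^ (j + 2) * x ^ (n - j) * (n + 2).choose (j + 2) by
        rw [show n + 2 - (j + 1 + 1) = n - j by omega]]
    push_cast
    ring
  rw [e, Finset.sum_mul]
  refine (Finset.abs_sum_le_sum_abs _ _).trans (Finset.sum_le_sum fun j hj => ?_)
  have hj' : j ≤ n := Nat.lt_succ_iff.1 (Finset.mem_range.1 hj)
  rw [abs_mul, abs_mul, abs_pow, abs_pow, Nat.abs_cast, pow_add, sq_abs]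
  have h1 : |x| ^ (n - j) ≤ 1 + |x| ^ n := by
    rcases le_total |x| 1 with h | h
    · linarith [pow_le_one₀ (n := n - j) (abs_nonneg x) h, pow_nonneg (abs_nonneg x) n]
    · linarith [pow_le_pow_right₀ h (Nat.sub_le n j)]
  have h2 : |d| ^ j ≤ |D| ^ j := pow_le_pow_left₀ (abs_nonneg _) (hd.trans (le_abs_self _)) _
  calc |d| ^ j * d ^ 2 * |x| ^ (n - j) * (n + 2).choose (j + 2)
      ≤ |D| ^ j * d ^ 2 * (1 + |x| ^ n) * (n + 2).choose (j + 2) := by gcongr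
    _ = _ := by ring

section LinearRecursion

variable {Ω : Type*} [mΩ : MeasurableSpace Ω] {P : Measure Ω} {ℱ : Filtration ℕ mΩ}
  {g β ε : ℕ → ℝ} {C D : ℝ} {Y q : ℕ → Ω → ℝ}

lemma IsLinearRecursion.measurable (h : IsLinearRecursion P ℱ g C Y q) (n : ℕ) : Measurable (Y n) :=
  ((h.stronglyMeasurable n).mono (ℱ.le n)).measurable

lemma IsLinearRecursion.exists_abs_step_le (h : IsLinearRecursion P ℱ g C Y q) (n : ℕ) :
    ∃ B, ∀ ω, |Y (n + 1) ω - g n * Y n ω| ≤ B := by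
  obtain ⟨B, hB⟩ := h.bounded n
  obtain ⟨B', hB'⟩ := h.bounded (n + 1)
  refine ⟨B' + |g n| * B, fun ω => (abs_sub _ _).trans (add_le_add (hB' ω) ?_)⟩
  rw [abs_mul]
  exact mul_le_mul_of_nonneg_left (hB ω) (abs_nonneg _)

lemma IsLinearRecursion.measurable_step (h : IsLinearRecursion P ℱ g C Y q) (n : ℕ) :
    Measurable (fun ω => Y (n + 1) ω - g n * Y n ω) :=
  (h.measurable (n + 1)).sub ((h.measurable n).const_mul _)

variable [IsProbabilityMeasure P]

lemma integrable_of_forall_abs_le {f : Ω → ℝ} (hf : Measurable f) (hB : ∃ B, ∀ ω, |f ω| ≤ B) :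
    Integrable f P := by
  obtain ⟨B, hB⟩ := hB
  exact Integrable.of_bound hf.aestronglyMeasurable B (Eventually.of_forall hB)

/-- Boundedness in `L²` gives uniform integrability. The part of the difference above a level `R`
contributes at most `4 B / R`, and the truncated part vanishes by dominated convergence. -/
lemma tendsto_integral_of_integral_sq_le {V : ℕ → Ω → ℝ} {V' : Ω → ℝ} {B : ℝ}
    (hm : ∀ n, Measurable (V n)) (hb : ∀ n, ∃ R, ∀ ω, |V n ω| ≤ R) (hm' : Measurable V')
    (hlim : ∀ᵐ ω ∂P, Tendsto (fun n => V n ω) atTop (𝓝 (V' ω)))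
    (hB : ∀ n, ∫ ω, V n ω ^ 2 ∂P ≤ B) :
    Integrable V' P ∧ Tendsto (fun n => ∫ ω, V n ω ∂P) atTop (𝓝 (∫ ω, V' ω ∂P)) := by
  have hbsq : ∀ n, ∃ R, ∀ ω, |V n ω ^ 2| ≤ R := fun n => by
    obtain ⟨R, hR⟩ := hb n
    refine ⟨R ^ 2, fun ω => ?_⟩
    have := hR ω
    rw [abs_pow]; gcongr
  have hint : ∀ n, Integrable (V n) P := fun n => integrable_of_forall_abs_le (hm n) (hb n)
  have hintsq : ∀ n, Integrable (fun ω => V n ω ^ 2) P := fun n =>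
    integrable_of_forall_abs_le ((hm n).pow_const 2) (hbsq n)
  -- Fatou's lemma transfers the second moment bound to the limit.
  have hfatou : eLpNorm (fun ω => V' ω ^ 2) 1 P ≤ ENNReal.ofReal B := by
    refine (Lp.eLpNorm_lim_le_liminf_eLpNorm (f := fun n ω => V n ω ^ 2)
      (fun n => ((hm n).pow_const 2).aestronglyMeasurable) (fun ω => V' ω ^ 2)
      (hlim.mono fun ω h => h.pow 2)).trans ?_
    refine (liminf_le_liminf (Eventually.of_forall fun n => ?_)).trans
      (liminf_const (f := (atTop : Filter ℕ)) (ENNReal.ofReal B)).le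
    rw [eLpNorm_one_eq_lintegral_enorm, ← ofReal_integral_norm_eq_lintegral_enorm (hintsq n)]
    refine ENNReal.ofReal_le_ofReal (le_trans (le_of_eq ?_) (hB n))
    simp only [norm_pow, Real.norm_eq_abs, sq_abs]
  have hB0 : 0 ≤ B := (integral_nonneg fun ω => sq_nonneg _).trans (hB 0)
  have hintsq' : Integrable (fun ω => V' ω ^ 2) P :=
    memLp_one_iff_integrable.1 ⟨(hm'.pow_const 2).aestronglyMeasurable,
      hfatou.trans_lt ENNReal.ofReal_lt_top⟩
  have hB' : ∫ ω, V' ω ^ 2 ∂P ≤ B := by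
    rw [eLpNorm_one_eq_lintegral_enorm, ← ofReal_integral_norm_eq_lintegral_enorm hintsq',
      ENNReal.ofReal_le_ofReal_iff hB0] at hfatou
    refine le_trans (le_of_eq ?_) hfatou
    simp only [norm_pow, Real.norm_eq_abs, sq_abs]
  have hint' : Integrable V' P := by
    refine ((integrable_const (1 : ℝ)).add hintsq').mono' hm'.aestronglyMeasurable
      (Eventually.of_forall fun ω => ?_)
    rw [Real.norm_eq_abs, Pi.add_apply]
    nlinarith [sq_abs (V' ω), sq_nonneg (|V' ω| - 1)]
  refine ⟨hint', ?_⟩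
  have htrunc : ∀ R : ℝ, 0 < R →
      Tendsto (fun n => ∫ ω, min |V n ω - V' ω| R ∂P) atTop (𝓝 0) := by
    intro R hR
    rw [← integral_zero Ω ℝ (μ := P)]
    refine tendsto_integral_of_dominated_convergence (fun _ => R)
      (fun n => (((hm n).sub hm').abs.min measurable_const).aestronglyMeasurable)
      (integrable_const R) (fun n => Eventually.of_forall fun ω => ?_) ?_
    · rw [Real.norm_eq_abs, abs_of_nonneg (le_min (abs_nonneg _) hR.le)]
      exact min_le_right _ _
    · filter_upwards [hlim] with ω h
      have h1 : Tendsto (fun n => |V n ω - V' ω|) atTop (𝓝 0) := by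
        simpa using (h.sub_const (V' ω)).abs
      simpa [hR.le] using h1.min (tendsto_const_nhds (x := R))
  have hbound : ∀ R : ℝ, 0 < R → ∀ n, |∫ ω, V n ω ∂P - ∫ ω, V' ω ∂P|
      ≤ ∫ ω, min |V n ω - V' ω| R ∂P + 4 * B / R := by
    intro R hR n
    have hi1 : Integrable (fun ω => |V n ω - V' ω|) P := ((hint n).sub hint').abs
    have hi2 : Integrable (fun ω => min |V n ω - V' ω| R) P := hi1.inf (integrable_const R)
    have hi3 : Integrable (fun ω => 2 / R * (V n ω ^ 2 + V' ω ^ 2)) P :=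
      ((hintsq n).add hintsq').const_mul _
    rw [← integral_sub (hint n) hint']
    calc |∫ ω, (V n ω - V' ω) ∂P| ≤ ∫ ω, |V n ω - V' ω| ∂P := abs_integral_le_integral_abs
      _ ≤ ∫ ω, (min |V n ω - V' ω| R + 2 / R * (V n ω ^ 2 + V' ω ^ 2)) ∂P := by
          refine integral_mono hi1 (hi2.add hi3) fun ω => ?_
          dsimp only
          rcases le_total |V n ω - V' ω| R with h | h
          · rw [min_eq_left h]
            have : 0 ≤ 2 / R * (V n ω ^ 2 + V' ω ^ 2) := by positivity
            linarith
          · have h1 : |V n ω - V' ω| ≤ |V n ω - V' ω| ^ 2 / R := by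
              rw [le_div_iff₀ hR, sq]
              exact mul_le_mul_of_nonneg_left h (abs_nonneg _)
            have h2 : |V n ω - V' ω| ^ 2 / R ≤ 2 / R * (V n ω ^ 2 + V' ω ^ 2) := by
              rw [div_le_iff₀ hR, sq_abs]
              field_simp
              nlinarith [sq_nonneg (V n ω + V' ω)]
            have h3 : 0 ≤ min |V n ω - V' ω| R := le_min (abs_nonneg _) hR.le
            linarith
      _ = ∫ ω, min |V n ω - V' ω| R ∂P
          + 2 / R * (∫ ω, V n ω ^ 2 ∂P + ∫ ω, V' ω ^ 2 ∂P) := by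
          rw [integral_add hi2 hi3, integral_const_mul, integral_add (hintsq n) hintsq']
      _ ≤ ∫ ω, min |V n ω - V' ω| R ∂P + 2 / R * (B + B) := by
          have := hB n
          gcongr
      _ = _ := by ring
  rw [tendsto_iff_norm_sub_tendsto_zero, Metric.tendsto_atTop]
  intro ε hε
  -- This level makes the tail `4 B / R` smaller than `ε / 2`, also when `B = 0`.
  have hR : 0 < 8 * (B + 1) / ε := by positivity
  obtain ⟨N, hN⟩ := Metric.tendsto_atTop.1 (htrunc _ hR) (ε / 2) (half_pos hε)
  refine ⟨N, fun n hn => ?_⟩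
  have h1 := hN n hn
  rw [Real.dist_eq, sub_zero] at h1
  have h2 := hbound _ hR n
  have h3 : 4 * B / (8 * (B + 1) / ε) < ε / 2 := by
    rw [div_div_eq_mul_div, div_lt_iff₀ (by positivity)]
    nlinarith
  rw [Real.dist_eq, sub_zero, Real.norm_eq_abs, abs_abs]
  linarith [le_abs_self (∫ ω, min |V n ω - V' ω| (8 * (B + 1) / ε) ∂P)]

lemma convergesWithMoments_of_moment_le {X : ℕ → Ω → ℝ} {Z : Ω → ℝ}
    (hm : ∀ n, Measurable (X n)) (hb : ∀ n, ∃ R, ∀ ω, |X n ω| ≤ R) (hZ : Measurable Z)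
    (hlim : ∀ᵐ ω ∂P, Tendsto (fun n => X n ω) atTop (𝓝 (Z ω)))
    (hB : ∀ s : ℕ, ∃ B, ∀ n, ∫ ω, X n ω ^ (2 * s) ∂P ≤ B) :
    ConvergesWithMoments P X Z := by
  have hbp : ∀ s n, ∃ R, ∀ ω, |X n ω ^ s| ≤ R := fun s n => by
    obtain ⟨R, hR⟩ := hb n
    refine ⟨R ^ s, fun ω => ?_⟩
    have := hR ω
    rw [abs_pow]; gcongr
  have key : ∀ s : ℕ, Integrable (fun ω => Z ω ^ s) P ∧
      Tendsto (fun n => ∫ ω, X n ω ^ s ∂P) atTop (𝓝 (∫ ω, Z ω ^ s ∂P)) := by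
    intro s
    obtain ⟨B, hB⟩ := hB s
    refine tendsto_integral_of_integral_sq_le (B := B) (fun n => (hm n).pow_const s) (hbp s)
      (hZ.pow_const s) (hlim.mono fun ω h => h.pow s) fun n => ?_
    simpa only [← pow_mul, mul_comm s 2] using hB n
  exact ⟨hZ, hlim, fun s _ n => integrable_of_forall_abs_le ((hm n).pow_const s) (hbp s n),
    fun s _ => (key s).1, fun s _ => (key s).2⟩

namespace IsLinearRecursion

lemma integrable (h : IsLinearRecursion P ℱ g C Y q) (n : ℕ) : Integrable (Y n) P :=
  integrable_of_forall_abs_le (h.measurable n) (h.bounded n)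

lemma integrable_step (h : IsLinearRecursion P ℱ g C Y q) (n : ℕ) :
    Integrable (fun ω => Y (n + 1) ω - g n * Y n ω) P :=
  integrable_of_forall_abs_le (h.measurable_step n) (h.exists_abs_step_le n)

lemma martingale (h : IsLinearRecursion P ℱ g C Y q) (hβ : ∀ n, 0 < β n)
    (hβg : ∀ n, β (n + 1) = β n * g n) : Martingale (fun n ω => Y n ω / β n) ℱ P := by
  refine martingale_of_setIntegral_eq_succ
    (fun n => (h.stronglyMeasurable n).div stronglyMeasurable_const)
    (fun n => (h.integrable n).div_const _) fun n s hs => ?_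
  have h1 := h.integral_mul_step n (s.indicator fun _ => 1)
    (stronglyMeasurable_const.indicator hs) ⟨1, fun ω => by
      by_cases hω : ω ∈ s <;> simp [hω]⟩
  have h2 : ∀ ω, s.indicator (fun _ => (1 : ℝ)) ω * (Y (n + 1) ω - g n * Y n ω)
      = s.indicator (fun ω => Y (n + 1) ω - g n * Y n ω) ω := fun ω => by
    by_cases hω : ω ∈ s <;> simp [hω]
  simp only [h2] at h1
  rw [integral_indicator (ℱ.le n _ hs), integral_sub (h.integrable _).integrableOn
    ((h.integrable n).const_mul _).integrableOn, integral_const_mul] at h1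
  rw [integral_div, integral_div, hβg]
  have h3 := hβ n
  have h4 : g n ≠ 0 := fun h0 => by have := hβ (n + 1); rw [hβg, h0] at this; simp at this
  rw [sub_eq_zero.1 h1]
  field_simp

/-- Expand `M (n+1) ^ (2 s)` around `M n`: the linear term has mean zero, and the remainder is
controlled by the conditional variance. One plus the moment therefore grows by factors `1 + 3 A ε
n`, whose product is bounded by the exponential of a convergent sum. Each moment is treated on its
own, without induction on `s`. -/
lemma exists_moment_le (h : IsLinearRecursion P ℱ g C Y q) (hβ : ∀ n, 0 < β n)
    (hβg : ∀ n, β (n + 1) = β n * g n) (hD : ∀ n, C / β (n + 1) ≤ D) (hε : Summable ε)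
    (hε0 : ∀ n, 0 ≤ ε n)
    (hq : ∀ n, ∀ᵐ ω ∂P, q n ω / β (n + 1) ^ 2 ≤ ε n * (1 + (Y n ω / β n) ^ 2)) (s : ℕ) :
    ∃ B, ∀ n, ∫ ω, (Y n ω / β n) ^ (2 * s) ∂P ≤ B := by
  rcases s with _ | s
  · exact ⟨1, fun n => by simp⟩
  obtain ⟨A, hA0, hA⟩ := exists_abs_add_pow_sub_le (2 * s) D
  set M : ℕ → Ω → ℝ := fun n ω => Y n ω / β n with hM
  have hMm : ∀ n, StronglyMeasurable[ℱ n] (M n) := fun n =>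
    (h.stronglyMeasurable n).div stronglyMeasurable_const
  have hMb : ∀ n, ∃ B, ∀ ω, |M n ω| ≤ B := fun n => by
    obtain ⟨B, hB⟩ := h.bounded n
    refine ⟨B / β n, fun ω => ?_⟩
    rw [abs_div, abs_of_pos (hβ n)]
    have := hB ω
    have := hβ n
    gcongr
  have hMpb : ∀ n k, ∃ B, ∀ ω, |M n ω ^ k| ≤ B := fun n k => by
    obtain ⟨B, hB⟩ := hMb n
    refine ⟨B ^ k, fun ω => ?_⟩
    have := hB ω
    rw [abs_pow]; gcongr
  have hMp : ∀ n k, Integrable (fun ω => M n ω ^ k) P := fun n k =>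
    integrable_of_forall_abs_le (((hMm n).mono (ℱ.le n)).measurable.pow_const k) (hMpb n k)
  set d : ℕ → Ω → ℝ := fun n ω => (Y (n + 1) ω - g n * Y n ω) / β (n + 1) with hd
  have hMd : ∀ n ω, M (n + 1) ω = d n ω + M n ω := by
    intro n ω
    have h1 := hβ n
    have h2 := hβ (n + 1)
    have h4 : g n ≠ 0 := fun h0 => by rw [hβg, h0] at h2; simp at h2
    simp only [hM, hd, hβg]
    field_simp
    ring
  have hstep : ∀ n, 1 + ∫ ω, M (n + 1) ω ^ (2 * (s + 1)) ∂P
      ≤ (1 + 3 * A * ε n) * (1 + ∫ ω, M n ω ^ (2 * (s + 1)) ∂P) := by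
    intro n
    have hβ1 := hβ (n + 1)
    have hdb : ∀ᵐ ω ∂P, |d n ω| ≤ D := by
      filter_upwards [h.step_le n] with ω hω
      rw [hd, abs_div, abs_of_pos hβ1]
      exact (div_le_div_of_nonneg_right hω hβ1.le).trans (hD n)
    have hdint : ∀ Z : Ω → ℝ, StronglyMeasurable[ℱ n] Z → (∃ B, ∀ ω, |Z ω| ≤ B) →
        Integrable (fun ω => Z ω * d n ω) P := by
      intro Z hZ ⟨B, hB⟩
      exact ((h.integrable_step n).div_const _).bdd_mul (c := B)
        (hZ.mono (ℱ.le n)).aestronglyMeasurable (Eventually.of_forall hB)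
    have hd2int : ∀ Z : Ω → ℝ, StronglyMeasurable[ℱ n] Z → (∃ B, ∀ ω, |Z ω| ≤ B) →
        Integrable (fun ω => Z ω * d n ω ^ 2) P := by
      intro Z hZ ⟨B, hB⟩
      obtain ⟨R, hR⟩ := h.exists_abs_step_le n
      refine Integrable.bdd_mul (c := B) (integrable_of_forall_abs_le
        (((h.measurable_step n).div_const _).pow_const 2) ⟨(R / β (n + 1)) ^ 2, fun ω => ?_⟩)
        (hZ.mono (ℱ.le n)).aestronglyMeasurable (Eventually.of_forall hB)
      have := hR ω
      rw [abs_pow, hd, abs_div, abs_of_pos hβ1]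
      gcongr
    have hZ1 : StronglyMeasurable[ℱ n] fun ω => (((2 * s : ℕ) : ℝ) + 2) * M n ω ^ (2 * s + 1) :=
      ((hMm n).pow _).const_mul _
    have hZ1b : ∃ B, ∀ ω, |(((2 * s : ℕ) : ℝ) + 2) * M n ω ^ (2 * s + 1)| ≤ B := by
      obtain ⟨B, hB⟩ := hMpb n (2 * s + 1)
      refine ⟨|((2 * s : ℕ) : ℝ) + 2| * B, fun ω => ?_⟩
      rw [abs_mul]
      exact mul_le_mul_of_nonneg_left (hB ω) (abs_nonneg _)
    have hZ2 : StronglyMeasurable[ℱ n] fun ω => A * (1 + M n ω ^ (2 * s)) :=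
      (stronglyMeasurable_const.add ((hMm n).pow _)).const_mul _
    have hZ2b : ∃ B, ∀ ω, |A * (1 + M n ω ^ (2 * s))| ≤ B := by
      obtain ⟨B, hB⟩ := hMpb n (2 * s)
      refine ⟨|A| * (1 + B), fun ω => ?_⟩
      rw [abs_mul]
      refine mul_le_mul_of_nonneg_left ((abs_add_le _ _).trans ?_) (abs_nonneg _)
      rw [abs_one]
      linarith [hB ω]
    have hzero : ∫ ω, (((2 * s : ℕ) : ℝ) + 2) * M n ω ^ (2 * s + 1) * d n ω ∂P = 0 := by
      simp only [hd, ← mul_div_assoc]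
      rw [integral_div, h.integral_mul_step n _ hZ1 hZ1b, zero_div]
    have hsq : ∫ ω, A * (1 + M n ω ^ (2 * s)) * d n ω ^ 2 ∂P
        = ∫ ω, A * (1 + M n ω ^ (2 * s)) * (q n ω / β (n + 1) ^ 2) ∂P := by
      simp only [hd, div_pow, ← mul_div_assoc]
      rw [integral_div, h.integral_mul_step_sq n _ hZ2 hZ2b, integral_div]
    have hmono : ∫ ω, M (n + 1) ω ^ (2 * (s + 1)) ∂P
        ≤ ∫ ω, (M n ω ^ (2 * (s + 1)) + (((2 * s : ℕ) : ℝ) + 2) * M n ω ^ (2 * s + 1) * d n ω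
            + A * (1 + M n ω ^ (2 * s)) * d n ω ^ 2) ∂P := by
      refine integral_mono_ae (hMp _ _)
        (((hMp _ _).add (hdint _ hZ1 hZ1b)).add (hd2int _ hZ2 hZ2b)) ?_
      filter_upwards [hdb] with ω hω
      have h1 := (abs_le.1 (hA (M n ω) (d n ω) hω)).2
      rw [(even_two_mul s).pow_abs] at h1
      rw [hMd, show 2 * (s + 1) = 2 * s + 2 by ring]
      linarith
    have hI : Integrable (fun ω => M n ω ^ (2 * (s + 1))
        + (((2 * s : ℕ) : ℝ) + 2) * M n ω ^ (2 * s + 1) * d n ω) P :=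
      (hMp _ _).add (hdint _ hZ1 hZ1b)
    rw [integral_add hI (hd2int _ hZ2 hZ2b),
      integral_add (hMp _ _) (hdint _ hZ1 hZ1b), hzero, hsq, add_zero] at hmono
    have hlast : ∫ ω, A * (1 + M n ω ^ (2 * s)) * (q n ω / β (n + 1) ^ 2) ∂P
        ≤ ∫ ω, 3 * A * ε n * (1 + M n ω ^ (2 * (s + 1))) ∂P := by
      refine integral_mono_of_nonneg (Eventually.of_forall fun ω => ?_)
        (((integrable_const 1).add (hMp _ _)).const_mul _) ?_
      · have h1 := h.var_nonneg n ω
        have h2 : 0 ≤ M n ω ^ (2 * s) := (even_two_mul s).pow_nonneg _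
        dsimp only [Pi.zero_apply]
        positivity
      · filter_upwards [hq n] with ω hω
        have h2 : 0 ≤ M n ω ^ (2 * s) := (even_two_mul s).pow_nonneg _
        -- The constant 3 absorbs the mixed powers: with `a = M ^ 2`, compare `a` and `a ^ s` with 1
        -- or with `a ^ (s + 1)`, according as `a ≤ 1` or `a ≥ 1`.
        have h3 : (1 + M n ω ^ (2 * s)) * (1 + M n ω ^ 2) ≤ 3 * (1 + M n ω ^ (2 * (s + 1))) := by
          rw [pow_mul, pow_mul]
          have h0 : 0 ≤ M n ω ^ 2 := sq_nonneg _
          set a := M n ω ^ 2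
          rcases le_total a 1 with h | h
          · have : a ^ s ≤ 1 := pow_le_one₀ h0 h
            have : 0 ≤ a ^ s := pow_nonneg h0 s
            rw [pow_succ]
            nlinarith
          · have : 1 ≤ a ^ s := one_le_pow₀ h
            rw [pow_succ]
            nlinarith
        calc _ ≤ A * (1 + M n ω ^ (2 * s)) * (ε n * (1 + M n ω ^ 2)) := by gcongr
          _ = A * ε n * ((1 + M n ω ^ (2 * s)) * (1 + M n ω ^ 2)) := by ring
          _ ≤ A * ε n * (3 * (1 + M n ω ^ (2 * (s + 1)))) :=
              mul_le_mul_of_nonneg_left h3 (mul_nonneg hA0 (hε0 n))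
          _ = _ := by ring
    rw [integral_const_mul, integral_add (integrable_const _) (hMp _ _)] at hlast
    simp only [integral_const, probReal_univ, smul_eq_mul, mul_one] at hlast
    linarith
  refine ⟨Real.exp (∑' n, 3 * A * ε n) * (1 + ∫ ω, M 0 ω ^ (2 * (s + 1)) ∂P), fun n => ?_⟩
  have hnn : ∀ n, 0 ≤ ∫ ω, M n ω ^ (2 * (s + 1)) ∂P := fun n =>
    integral_nonneg fun ω => (even_two_mul _).pow_nonneg _
  have hind : ∀ n, 1 + ∫ ω, M n ω ^ (2 * (s + 1)) ∂P
      ≤ Real.exp (∑ i ∈ Finset.range n, 3 * A * ε i) * (1 + ∫ ω, M 0 ω ^ (2 * (s + 1)) ∂P) := by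
    intro n
    induction n with
    | zero => simp
    | succ n ih =>
      have h1 : 1 + 3 * A * ε n ≤ Real.exp (3 * A * ε n) := by
        linarith [Real.add_one_le_exp (3 * A * ε n)]
      have h2 := hε0 n
      have h3 := hnn n
      rw [Finset.sum_range_succ, add_comm (∑ i ∈ Finset.range n, 3 * A * ε i), Real.exp_add,
        mul_assoc]
      exact (hstep n).trans (mul_le_mul h1 ih (by positivity) (Real.exp_pos _).le)
  have h1 : ∑ i ∈ Finset.range n, 3 * A * ε i ≤ ∑' n, 3 * A * ε n :=
    (hε.mul_left (3 * A)).sum_le_tsum _ fun i _ => by have := hε0 i; positivity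
  have h2 := hnn 0
  calc _ ≤ 1 + ∫ ω, M n ω ^ (2 * (s + 1)) ∂P := by simp only [hM]; linarith
    _ ≤ _ := (hind n).trans (by gcongr)

/-- The second moment bound makes the martingale bounded in `L¹`, so Doob's theorem applies. The
rate `r` may differ from `β` by a convergent factor, which allows `n ^ Λ` in place of Gamma
quotients. -/
theorem exists_convergesWithMoments {r : ℕ → ℝ} {c : ℝ}
    (h : IsLinearRecursion P ℱ g C Y q) (hβ : ∀ n, 0 < β n)
    (hβg : ∀ n, β (n + 1) = β n * g n) (hD : ∀ n, C / β (n + 1) ≤ D) (hε : Summable ε)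
    (hε0 : ∀ n, 0 ≤ ε n)
    (hq : ∀ n, ∀ᵐ ω ∂P, q n ω / β (n + 1) ^ 2 ≤ ε n * (1 + (Y n ω / β n) ^ 2))
    (hr : Tendsto (fun n => β n / r n) atTop (𝓝 c)) :
    ∃ Z, ConvergesWithMoments P (fun n ω => Y n ω / r n) Z := by
  have hmom := h.exists_moment_le hβ hβg hD hε hε0 hq
  have hmart := h.martingale hβ hβg
  obtain ⟨B, hB⟩ := hmom 1
  have hint : ∀ n, Integrable (fun ω => (Y n ω / β n) ^ 2) P := fun n => by
    obtain ⟨R, hR⟩ := h.bounded n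
    refine integrable_of_forall_abs_le (((h.measurable n).div_const _).pow_const 2)
      ⟨(R / β n) ^ 2, fun ω => ?_⟩
    rw [abs_pow, abs_div, abs_of_pos (hβ n)]
    have := hR ω
    have := hβ n
    gcongr
  have hL1 : ∀ n, eLpNorm (fun ω => Y n ω / β n) 1 P ≤ ((1 + B).toNNReal : ENNReal) := by
    intro n
    have hi := (h.integrable n).div_const (β n)
    rw [eLpNorm_one_eq_lintegral_enorm, ← ofReal_integral_norm_eq_lintegral_enorm hi]
    refine ENNReal.ofReal_le_ofReal ?_
    calc ∫ ω, ‖Y n ω / β n‖ ∂P ≤ ∫ ω, (1 + (Y n ω / β n) ^ 2) ∂P := by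
          refine integral_mono hi.norm ((integrable_const 1).add (hint n)) fun ω => ?_
          simp only [Real.norm_eq_abs]
          nlinarith [sq_abs (Y n ω / β n), sq_nonneg (|Y n ω / β n| - 1)]
      _ = 1 + ∫ ω, (Y n ω / β n) ^ 2 ∂P := by
          rw [integral_add (integrable_const 1) (hint n)]; simp
      _ ≤ 1 + B := by gcongr; exact hB n
  obtain ⟨Z, hZ, hconv⟩ : ∃ Z : Ω → ℝ, Measurable Z ∧
      ∀ᵐ ω ∂P, Tendsto (fun n => Y n ω / β n) atTop (𝓝 (Z ω)) :=
    ⟨_, Filtration.stronglyMeasurable_limit_process'.measurable,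
      hmart.submartingale.ae_tendsto_limitProcess hL1⟩
  refine ⟨fun ω => Z ω * c,
    convergesWithMoments_of_moment_le (fun n => (h.measurable n).div_const _) (fun n => ?_)
      (hZ.mul_const c) ?_ fun s => ?_⟩
  · obtain ⟨R, hR⟩ := h.bounded n
    refine ⟨R / |r n|, fun ω => ?_⟩
    rw [abs_div]
    have := hR ω
    gcongr
  · filter_upwards [hconv] with ω hω
    refine (hω.mul hr).congr fun n => ?_
    rw [div_mul_div_cancel₀ (hβ n).ne']
  · obtain ⟨B, hB⟩ := hmom s
    obtain ⟨R, hR⟩ := (hr.pow (2 * s)).bddAbove_range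
    refine ⟨B * R, fun n => ?_⟩
    have e : ∀ ω, (Y n ω / r n) ^ (2 * s) = (Y n ω / β n) ^ (2 * s) * (β n / r n) ^ (2 * s) :=
      fun ω => by rw [← mul_pow, div_mul_div_cancel₀ (hβ n).ne']
    simp only [e]
    rw [integral_mul_const]
    have h0 : 0 ≤ ∫ ω, (Y n ω / β n) ^ (2 * s) ∂P :=
      integral_nonneg fun ω => (even_two_mul _).pow_nonneg _
    exact mul_le_mul (hB n) (hR ⟨n, rfl⟩) ((even_two_mul s).pow_nonneg _) (h0.trans (hB n))

end IsLinearRecursion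

end LinearRecursion

/-! ### The central limit theorem by characteristic functions. -/

lemma norm_exp_mul_I_sub_le (y : ℝ) :
    ‖Complex.exp (y * Complex.I) - (1 + y * Complex.I - (y : ℂ) ^ 2 / 2)‖ ≤ 4 * |y| ^ 3 := by
  rcases le_total |y| 1 with h | h
  · have hn : ‖(y : ℂ) * Complex.I‖ = |y| := by simp
    have := Complex.exp_bound (x := y * Complex.I) (by rw [hn]; exact h) (n := 3) (by norm_num)
    rw [hn] at this
    have e : ∑ m ∈ Finset.range 3, ((y : ℂ) * Complex.I) ^ m / (m.factorial : ℂ)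
        = 1 + y * Complex.I - (y : ℂ) ^ 2 / 2 := by
      simp [Finset.sum_range_succ, mul_pow, Nat.factorial]
      ring
    rw [e] at this
    refine this.trans ?_
    have h0 : (0 : ℝ) ≤ |y| ^ 3 := by positivity
    norm_num [Nat.factorial]
    linarith
  · have h1 : ‖(1 : ℂ) + y * Complex.I - (y : ℂ) ^ 2 / 2‖ ≤ 1 + |y| + |y| ^ 2 / 2 := by
      refine (norm_sub_le _ _).trans (add_le_add ((norm_add_le _ _).trans ?_) ?_) <;> simp
    refine (norm_sub_le _ _).trans ?_
    rw [Complex.norm_exp_ofReal_mul_I]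
    have h2 : |y| ≤ |y| ^ 2 := by nlinarith
    have h3 : |y| ^ 2 ≤ |y| ^ 3 := by nlinarith
    linarith

lemma abs_exp_neg_sub_le {a y : ℝ} (ha : 0 ≤ a) (hy : 0 ≤ y) (hay : a ≤ y ^ 2) :
    |Real.exp (-a) - (1 - a)| ≤ y ^ 3 := by
  have h1 : 0 ≤ Real.exp (-a) - (1 - a) := by linarith [Real.add_one_le_exp (-a)]
  rw [abs_of_nonneg h1]
  rcases le_total y 1 with h | h
  · have ha1 : |-a| ≤ 1 := by rw [abs_neg, abs_of_nonneg ha]; nlinarith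
    have h2 := (abs_le.1 (Real.abs_exp_sub_one_sub_id_le ha1)).2
    have h3 : a ^ 2 ≤ (y ^ 2) ^ 2 := by gcongr
    have h4 : (y ^ 2) ^ 2 ≤ y ^ 3 := by
      have : 0 ≤ y ^ 3 := by positivity
      nlinarith
    nlinarith
  · have h2 : Real.exp (-a) ≤ 1 := Real.exp_le_one_iff.2 (by linarith)
    nlinarith [sq_nonneg y]

lemma tendsto_weighted_average {w e : ℕ → ℝ} (hw : ∀ n, 0 ≤ w n)
    (hS : Tendsto (fun n => ∑ j ∈ Finset.range n, w j) atTop atTop)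
    (he : Tendsto e atTop (𝓝 0)) :
    Tendsto (fun n => (∑ j ∈ Finset.range n, w j * e j) / ∑ j ∈ Finset.range n, w j)
      atTop (𝓝 0) := by
  have h1 : (fun n => w n * e n) =o[atTop] w := by
    have := (Asymptotics.isBigO_refl w atTop).mul_isLittleO
      ((Asymptotics.isLittleO_one_iff ℝ).2 he)
    simpa using this
  exact (h1.sum_range hw hS).tendsto_div_nhds_zero

/-- The Lyapunov condition: `u j ≤ √(u j ^ 2 / S (j + 1)) * √(S n)` for `j < n` turns the quotient
into a weighted average of a null sequence. -/
lemma tendsto_sum_cube_div {u : ℕ → ℝ} (hu : ∀ n, 0 < u n)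
    (hS : Tendsto (fun n => ∑ j ∈ Finset.range n, u j ^ 2) atTop atTop)
    (hr : Tendsto (fun n => u n ^ 2 / ∑ j ∈ Finset.range (n + 1), u j ^ 2) atTop (𝓝 0)) :
    Tendsto (fun n => (∑ j ∈ Finset.range n, u j ^ 3) / √(∑ j ∈ Finset.range n, u j ^ 2) ^ 3)
      atTop (𝓝 0) := by
  set S : ℕ → ℝ := fun n => ∑ j ∈ Finset.range n, u j ^ 2 with hSdef
  have hSpos : ∀ n, 0 < S (n + 1) := fun n =>
    Finset.sum_pos (fun j _ => by have := hu j; positivity) (by simp)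
  have hSmono : Monotone S := fun a b hab =>
    Finset.sum_le_sum_of_subset_of_nonneg (Finset.range_mono hab) fun _ _ _ => sq_nonneg _
  have he : Tendsto (fun n => √(u n ^ 2 / S (n + 1))) atTop (𝓝 0) := by
    simpa using hr.sqrt
  have h := tendsto_weighted_average (fun n => sq_nonneg (u n)) hS he
  refine tendsto_of_tendsto_of_tendsto_of_le_of_le' tendsto_const_nhds h
    (Eventually.of_forall fun n => ?_) ?_
  · exact div_nonneg (Finset.sum_nonneg fun j _ => by have := hu j; positivity) (by positivity)
  · filter_upwards [eventually_gt_atTop 0] with n hn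
    obtain ⟨k, rfl⟩ := Nat.exists_eq_succ_of_ne_zero hn.ne'
    have hs : 0 < √(S (k + 1)) := Real.sqrt_pos.2 (hSpos k)
    have hs2 : √(S (k + 1)) ^ 2 = S (k + 1) := Real.sq_sqrt (hSpos k).le
    change _ / √(S (k + 1)) ^ 3 ≤ _ / S (k + 1)
    have h5 : (∑ j ∈ Finset.range (k + 1), u j ^ 3)
        ≤ (∑ j ∈ Finset.range (k + 1), u j ^ 2 * √(u j ^ 2 / S (j + 1))) * √(S (k + 1)) := by
      rw [Finset.sum_mul]
      refine Finset.sum_le_sum fun j hj => ?_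
      have hj' : j + 1 ≤ k + 1 := Finset.mem_range.1 hj
      rw [Real.sqrt_div (sq_nonneg _), Real.sqrt_sq (hu j).le]
      have h1 : √(S (j + 1)) ≤ √(S (k + 1)) := Real.sqrt_le_sqrt (hSmono hj')
      have h2 : 0 < √(S (j + 1)) := Real.sqrt_pos.2 (hSpos j)
      have h3 : u j ≤ u j / √(S (j + 1)) * √(S (k + 1)) := by
        rw [div_mul_eq_mul_div, le_div_iff₀ h2]
        exact mul_le_mul_of_nonneg_left h1 (hu j).le
      calc u j ^ 3 = u j ^ 2 * u j := by ring
        _ ≤ u j ^ 2 * (u j / √(S (j + 1)) * √(S (k + 1))) :=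
          mul_le_mul_of_nonneg_left h3 (sq_nonneg _)
        _ = _ := by ring
    calc _ ≤ (∑ j ∈ Finset.range (k + 1), u j ^ 2 * √(u j ^ 2 / S (j + 1))) * √(S (k + 1))
          / √(S (k + 1)) ^ 3 := div_le_div_of_nonneg_right h5 (by positivity)
      _ = (∑ j ∈ Finset.range (k + 1), u j ^ 2 * √(u j ^ 2 / S (j + 1))) / √(S (k + 1)) ^ 2 := by
          field_simp
      _ = _ := by rw [hs2]

section GrowthWeights

variable {x l : ℝ}

/-- For `l ≤ 1/2` the squared products grow at most linearly, so the harmonic series is a minorant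
up to a constant. -/
lemma tendsto_sum_inv_growthProd_sq (hx : 0 < x) (hxl : 0 < x + l) (hl : l ≤ 1 / 2) :
    Tendsto (fun n => ∑ j ∈ Finset.range n, ((growthProd x l (j + 1))⁻¹) ^ 2) atTop atTop := by
  rw [← not_summable_iff_tendsto_nat_atTop_of_nonneg fun n => sq_nonneg _]
  intro hsum
  obtain ⟨A, B, hA, hB, hAB⟩ := exists_growthProd_bounds hx hxl
  have h1 : Summable fun n : ℕ => 1 / ((n + 2 : ℕ) : ℝ) := by
    refine Summable.of_nonneg_of_le (fun n => by positivity) (fun n => ?_) (hsum.mul_left (B ^ 2))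
    have h2 := (hAB (n + 1)).2
    have h3 := growthProd_pos hx hxl (n + 1)
    have h4 : ((n + 1 : ℕ) : ℝ) + 1 = ((n + 2 : ℕ) : ℝ) := by push_cast; ring
    rw [h4] at h2
    have h5 : (1 : ℝ) ≤ ((n + 2 : ℕ) : ℝ) := by push_cast; linarith [(Nat.cast_nonneg n : (0:ℝ) ≤ n)]
    have h6 : growthProd x l (n + 1) ^ 2 ≤ B ^ 2 * ((n + 2 : ℕ) : ℝ) := by
      calc growthProd x l (n + 1) ^ 2 ≤ (B * ((n + 2 : ℕ) : ℝ) ^ l) ^ 2 := by gcongr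
        _ = B ^ 2 * (((n + 2 : ℕ) : ℝ) ^ l) ^ 2 := by ring
        _ ≤ B ^ 2 * (((n + 2 : ℕ) : ℝ) ^ ((1 : ℝ) / 2)) ^ 2 := by gcongr
        _ = B ^ 2 * ((n + 2 : ℕ) : ℝ) := by
          rw [← Real.sqrt_eq_rpow, Real.sq_sqrt (by positivity)]
    rw [inv_pow, ← div_eq_mul_inv, div_le_div_iff₀ (by positivity) (by positivity)]
    linarith
  rw [summable_nat_add_iff (f := fun n : ℕ => 1 / (n : ℝ)) 2] at h1
  exact Real.not_summable_one_div_natCast h1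

/-- The weights vary slowly, so that the last one is `O(1 / n)` of the sum, whatever `l` is. -/
lemma tendsto_inv_growthProd_sq_div_sum (hx : 0 < x) (hxl : 0 < x + l) :
    Tendsto (fun n => ((growthProd x l (n + 1))⁻¹) ^ 2
      / ∑ j ∈ Finset.range (n + 1), ((growthProd x l (j + 1))⁻¹) ^ 2) atTop (𝓝 0) := by
  set w : ℕ → ℝ := fun j => ((growthProd x l (j + 1))⁻¹) ^ 2 with hw
  have hwpos : ∀ n, 0 < w n := fun n => by
    have := growthProd_pos hx hxl (n + 1)
    positivity
  -- Passing from `n` to `n + 1` adds `w (n+1)` plus `(n + 1) * (w (n+1) - w n)` on the left, and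
  -- the latter is at most `2 |l| w (n+1)`.
  have key : ∀ n : ℕ, ((n : ℝ) + 1) * w n ≤ (1 + 2 * |l|) * ∑ j ∈ Finset.range (n + 1), w j := by
    intro n
    induction n with
    | zero =>
      have := hwpos 0
      simp only [zero_add, Finset.range_one, Finset.sum_singleton, Nat.cast_zero]
      nlinarith [abs_nonneg l]
    | succ n ih =>
      rw [Finset.sum_range_succ, mul_add]
      have hg := one_add_div_pos hx hxl (n + 1)
      have hwn : w n = w (n + 1) * (1 + l / ((n + 1 : ℕ) + x)) ^ 2 := by
        have h1 := growthProd_pos hx hxl (n + 1)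
        simp only [hw]
        rw [growthProd_succ x l (n + 1)]
        generalize 1 + l / (((n + 1 : ℕ) : ℝ) + x) = G at hg
        field_simp
      have hg2 : ((n : ℝ) + 1) * (1 - (1 + l / ((n + 1 : ℕ) + x)) ^ 2) ≤ 2 * |l| := by
        have hu : (0 : ℝ) < (n + 1 : ℕ) + x := by positivity
        rcases le_total 0 l with h | h
        · have h1 : 0 ≤ l / ((n + 1 : ℕ) + x) := by positivity
          have h2 : 1 - (1 + l / ((n + 1 : ℕ) + x)) ^ 2 ≤ 0 := by nlinarith
          have h3 : ((n : ℝ) + 1) * (1 - (1 + l / ((n + 1 : ℕ) + x)) ^ 2) ≤ 0 :=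
            mul_nonpos_of_nonneg_of_nonpos (by positivity) h2
          linarith [abs_nonneg l]
        · have h1 : 1 - (1 + l / ((n + 1 : ℕ) + x)) ^ 2 ≤ 2 * (|l| / ((n + 1 : ℕ) + x)) := by
            rw [abs_of_nonpos h, neg_div]
            nlinarith [sq_nonneg (l / ((n + 1 : ℕ) + x))]
          have h2 : ((n : ℝ) + 1) * (|l| / ((n + 1 : ℕ) + x)) ≤ |l| := by
            rw [← mul_div_assoc, div_le_iff₀ hu, mul_comm]
            push_cast
            exact mul_le_mul_of_nonneg_left (by linarith) (abs_nonneg l)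
          calc _ ≤ ((n : ℝ) + 1) * (2 * (|l| / ((n + 1 : ℕ) + x))) :=
              mul_le_mul_of_nonneg_left h1 (by positivity)
            _ ≤ 2 * |l| := by linarith
      have h3 := mul_le_mul_of_nonneg_left hg2 (hwpos (n + 1)).le
      push_cast at *
      rw [hwn] at ih
      nlinarith
  have hS : ∀ n : ℕ, 0 < ∑ j ∈ Finset.range (n + 1), w j := fun n =>
    Finset.sum_pos (fun j _ => hwpos j) (by simp)
  have hlim : Tendsto (fun n : ℕ => (1 + 2 * |l|) * (1 / ((n : ℝ) + 1))) atTop (𝓝 0) := by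
    simpa using tendsto_one_div_add_atTop_nhds_zero_nat.const_mul (1 + 2 * |l|)
  refine tendsto_of_tendsto_of_tendsto_of_le_of_le tendsto_const_nhds hlim
    (fun n => div_nonneg (hwpos n).le (hS n).le) fun n => ?_
  rw [div_le_iff₀ (hS n), mul_one_div, div_mul_eq_mul_div, le_div_iff₀ (by positivity)]
  linarith [key n]

end GrowthWeights

namespace IsLinearRecursion

variable {Ω : Type*} [mΩ : MeasurableSpace Ω] {P : Measure Ω}
  {ℱ : Filtration ℕ mΩ} {g β : ℕ → ℝ} {C : ℝ} {Y q : ℕ → Ω → ℝ}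

lemma integral_var_nonneg (h : IsLinearRecursion P ℱ g C Y q) (n : ℕ) : 0 ≤ ∫ ω, q n ω ∂P :=
  integral_nonneg (h.var_nonneg n)

variable [IsProbabilityMeasure P]

lemma integrable_sq (h : IsLinearRecursion P ℱ g C Y q) (n : ℕ) :
    Integrable (fun ω => Y n ω ^ 2) P := by
  obtain ⟨B, hB⟩ := h.bounded n
  refine integrable_of_forall_abs_le ((h.measurable n).pow_const 2) ⟨B ^ 2, fun ω => ?_⟩
  have := hB ω
  rw [abs_pow]; gcongr

lemma integrable_step_sq (h : IsLinearRecursion P ℱ g C Y q) (n : ℕ) :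
    Integrable (fun ω => (Y (n + 1) ω - g n * Y n ω) ^ 2) P := by
  obtain ⟨B, hB⟩ := h.exists_abs_step_le n
  refine integrable_of_forall_abs_le ((h.measurable_step n).pow_const 2) ⟨B ^ 2, fun ω => ?_⟩
  have := hB ω
  rw [abs_pow]; gcongr

lemma integrable_var (h : IsLinearRecursion P ℱ g C Y q) (n : ℕ) : Integrable (q n) P := by
  refine Integrable.of_bound
    ((h.stronglyMeasurable_var n).mono (ℱ.le n)).aestronglyMeasurable (C ^ 2) ?_
  filter_upwards [h.var_le n] with ω hω
  rwa [Real.norm_eq_abs, abs_of_nonneg (h.var_nonneg n ω)]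

lemma integral_var_le (h : IsLinearRecursion P ℱ g C Y q) (n : ℕ) : ∫ ω, q n ω ∂P ≤ C ^ 2 := by
  have := integral_mono_ae (h.integrable_var n) (integrable_const (C ^ 2)) (h.var_le n)
  simpa using this

lemma integral_sq_succ (h : IsLinearRecursion P ℱ g C Y q) (n : ℕ) :
    ∫ ω, Y (n + 1) ω ^ 2 ∂P = g n ^ 2 * ∫ ω, Y n ω ^ 2 ∂P + ∫ ω, q n ω ∂P := by
  have h1 := h.integral_mul_step n (Y n) (h.stronglyMeasurable n) (h.bounded n)
  have h2 := h.integral_mul_step_sq n (fun _ => 1) stronglyMeasurable_const ⟨1, by simp⟩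
  simp only [one_mul] at h2
  obtain ⟨B, hB⟩ := h.bounded n
  have hi1 : Integrable (fun ω => Y n ω * (Y (n + 1) ω - g n * Y n ω)) P :=
    (h.integrable_step n).bdd_mul (c := B) (h.measurable n).aestronglyMeasurable
      (Eventually.of_forall hB)
  have e : ∀ ω, Y (n + 1) ω ^ 2 = g n ^ 2 * Y n ω ^ 2
      + (2 * g n * (Y n ω * (Y (n + 1) ω - g n * Y n ω)) + (Y (n + 1) ω - g n * Y n ω) ^ 2) :=
    fun ω => by ring
  have hi2 : Integrable (fun ω => 2 * g n * (Y n ω * (Y (n + 1) ω - g n * Y n ω))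
      + (Y (n + 1) ω - g n * Y n ω) ^ 2) P := (hi1.const_mul _).add (h.integrable_step_sq n)
  simp only [e]
  rw [integral_add ((h.integrable_sq n).const_mul _) hi2,
    integral_add (hi1.const_mul _) (h.integrable_step_sq n), integral_const_mul,
    integral_const_mul, h1, h2, mul_zero, zero_add]

lemma integral_sq_div_eq (h : IsLinearRecursion P ℱ g C Y q) (hβ : ∀ n, 0 < β n)
    (hβg : ∀ n, β (n + 1) = β n * g n) (n : ℕ) :
    (∫ ω, Y n ω ^ 2 ∂P) / β n ^ 2 = (∫ ω, Y 0 ω ^ 2 ∂P) / β 0 ^ 2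
      + ∑ j ∈ Finset.range n, ((β (j + 1))⁻¹) ^ 2 * ∫ ω, q j ω ∂P := by
  induction n with
  | zero => simp
  | succ n ih =>
    rw [Finset.sum_range_succ, ← add_assoc, ← ih, h.integral_sq_succ]
    have h1 := hβ n
    have h2 := hβ (n + 1)
    have h3 : g n ≠ 0 := fun h0 => by rw [hβg, h0] at h2; simp at h2
    rw [hβg]
    field_simp

/-- The characteristic function of the rescaled process, one step. -/
lemma norm_integral_exp_step_le (h : IsLinearRecursion P ℱ g C Y q) (hβ : ∀ n, 0 < β n)
    (hβg : ∀ n, β (n + 1) = β n * g n) (θ : ℝ) (n : ℕ) :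
    ‖∫ ω, Complex.exp ((θ * (Y (n + 1) ω / β (n + 1)) : ℝ) * Complex.I) ∂P
      - Real.exp (-(θ ^ 2 / 2 * (((β (n + 1))⁻¹) ^ 2 * ∫ ω, q n ω ∂P)))
        * ∫ ω, Complex.exp ((θ * (Y n ω / β n) : ℝ) * Complex.I) ∂P‖
      ≤ θ ^ 2 / 2 * (((β (n + 1))⁻¹) ^ 2 * ∫ ω, |q n ω - ∫ ω', q n ω' ∂P| ∂P)
        + 5 * (|θ| * C) ^ 3 * (β (n + 1))⁻¹ ^ 3 := by
  set u : ℝ := (β (n + 1))⁻¹ with hu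
  have hu0 : 0 < u := inv_pos.2 (hβ _)
  set ξ : Ω → ℝ := fun ω => Y (n + 1) ω - g n * Y n ω with hξ
  set φ : Ω → ℝ := fun ω => θ * (Y n ω / β n) with hφ
  set v : ℝ := ∫ ω, q n ω ∂P with hv
  set a : ℝ := θ ^ 2 / 2 * (u ^ 2 * v) with ha
  have hφm : StronglyMeasurable[ℱ n] φ :=
    ((h.stronglyMeasurable n).div stronglyMeasurable_const).const_mul _
  have hcos : StronglyMeasurable[ℱ n] fun ω => Real.cos (φ ω) :=
    Real.continuous_cos.comp_stronglyMeasurable hφm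
  have hsin : StronglyMeasurable[ℱ n] fun ω => Real.sin (φ ω) :=
    Real.continuous_sin.comp_stronglyMeasurable hφm
  have hφm' : Measurable φ := (hφm.mono (ℱ.le n)).measurable
  set E : Ω → ℂ := fun ω => Complex.exp (φ ω * Complex.I) with hE
  have hEm : Measurable E := by fun_prop
  have hEn : ∀ ω, ‖E ω‖ = 1 := fun ω => Complex.norm_exp_ofReal_mul_I _
  have hEi : ∀ f : Ω → ℂ, Integrable f P → Integrable (fun ω => E ω * f ω) P := fun f hf =>
    hf.bdd_mul hEm.aestronglyMeasurable (Eventually.of_forall fun ω => (hEn ω).le)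
  -- The moment identities of the recursion concern real test functions, so the complex exponential
  -- is split into cosine and sine.
  have hsplit : ∀ f : Ω → ℝ, Integrable f P → ∫ ω, E ω * (f ω : ℂ) ∂P
      = ((∫ ω, Real.cos (φ ω) * f ω ∂P : ℝ) : ℂ)
        + ((∫ ω, Real.sin (φ ω) * f ω ∂P : ℝ) : ℂ) * Complex.I := by
    intro f hf
    have h1 : Integrable (fun ω => Real.cos (φ ω) * f ω) P :=
      hf.bdd_mul (hcos.mono (ℱ.le n)).aestronglyMeasurable
        (Eventually.of_forall fun ω => Real.abs_cos_le_one _)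
    have h2 : Integrable (fun ω => Real.sin (φ ω) * f ω) P :=
      hf.bdd_mul (hsin.mono (ℱ.le n)).aestronglyMeasurable
        (Eventually.of_forall fun ω => Real.abs_sin_le_one _)
    rw [← integral_complex_ofReal, ← integral_complex_ofReal, ← integral_mul_const,
      ← integral_add h1.ofReal (h2.ofReal.mul_const _)]
    refine integral_congr_ae (Eventually.of_forall fun ω => ?_)
    simp only [hE, Complex.exp_mul_I, Complex.ofReal_mul, Complex.ofReal_cos, Complex.ofReal_sin]
    ring
  have hξi : Integrable ξ P := h.integrable_step n
  have hξ2i : Integrable (fun ω => ξ ω ^ 2) P := h.integrable_step_sq n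
  have hqi : Integrable (q n) P := h.integrable_var n
  have h1 : ∫ ω, E ω * (ξ ω : ℂ) ∂P = 0 := by
    rw [hsplit ξ hξi, h.integral_mul_step n _ hcos ⟨1, fun ω => Real.abs_cos_le_one _⟩,
      h.integral_mul_step n _ hsin ⟨1, fun ω => Real.abs_sin_le_one _⟩]
    simp
  have h2 : ∫ ω, E ω * ((ξ ω ^ 2 : ℝ) : ℂ) ∂P = ∫ ω, E ω * (q n ω : ℂ) ∂P := by
    rw [hsplit _ hξ2i, hsplit _ hqi,
      h.integral_mul_step_sq n _ hcos ⟨1, fun ω => Real.abs_cos_le_one _⟩,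
      h.integral_mul_step_sq n _ hsin ⟨1, fun ω => Real.abs_sin_le_one _⟩]
  have hEE : Integrable E P := by simpa using hEi (fun _ => 1) (integrable_const 1)
  have hphase : ∀ ω, θ * (Y (n + 1) ω / β (n + 1)) = φ ω + θ * u * ξ ω := by
    intro ω
    have h3 := hβ n
    have h4 := hβ (n + 1)
    have h5 : g n ≠ 0 := fun h0 => by rw [hβg, h0] at h4; simp at h4
    simp only [hφ, hu, hξ, hβg]
    field_simp
    ring
  set R : Ω → ℂ := fun ω => Complex.exp ((θ * u * ξ ω : ℝ) * Complex.I)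
    - (1 + (θ * u * ξ ω : ℝ) * Complex.I - ((θ * u * ξ ω : ℝ) : ℂ) ^ 2 / 2) with hR
  have hRi : Integrable R P := by
    have e1 : Integrable (fun ω => Complex.exp ((θ * u * ξ ω : ℝ) * Complex.I)) P := by
      have hξm : Measurable ξ := h.measurable_step n
      refine Integrable.of_bound (by fun_prop) 1 (Eventually.of_forall fun ω => ?_)
      rw [Complex.norm_exp_ofReal_mul_I]
    have e2 : Integrable (fun ω => ((θ * u * ξ ω : ℝ) : ℂ) * Complex.I) P :=
      ((hξi.const_mul (θ * u)).ofReal).mul_const _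
    have e3 : Integrable (fun ω => ((θ * u * ξ ω : ℝ) : ℂ) ^ 2 / 2) P := by
      have := ((hξ2i.const_mul ((θ * u) ^ 2)).ofReal (𝕜 := ℂ)).div_const 2
      refine this.congr (Eventually.of_forall fun ω => ?_)
      simp only [RCLike.ofReal_eq_complex_ofReal] at *
      push_cast
      ring
    exact e1.sub (((integrable_const 1).add e2).sub e3)
  -- Three errors: the cubic Taylor remainder, the replacement of `1 - a` by `exp (-a)`, and the
  -- replacement of the conditional variance by its mean.
  have hdecomp : ∫ ω, Complex.exp ((θ * (Y (n + 1) ω / β (n + 1)) : ℝ) * Complex.I) ∂P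
      - Real.exp (-a) * ∫ ω, E ω ∂P
      = ∫ ω, E ω * R ω ∂P - ((Real.exp (-a) - (1 - a) : ℝ) : ℂ) * ∫ ω, E ω ∂P
        + (θ ^ 2 / 2 * u ^ 2 : ℝ) * ∫ ω, E ω * ((v - q n ω : ℝ) : ℂ) ∂P := by
    have e : ∀ ω, Complex.exp ((θ * (Y (n + 1) ω / β (n + 1)) : ℝ) * Complex.I)
        = E ω * R ω + (E ω + (θ * u * Complex.I * (E ω * (ξ ω : ℂ))
          + (-((θ * u) ^ 2 / 2 : ℂ)) * (E ω * ((ξ ω ^ 2 : ℝ) : ℂ)))) := by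
      intro ω
      rw [hphase, Complex.ofReal_add, add_mul, Complex.exp_add]
      simp only [hE, hR]
      push_cast
      ring
    have i1 : Integrable (fun ω => θ * u * Complex.I * (E ω * (ξ ω : ℂ))) P :=
      (hEi _ hξi.ofReal).const_mul _
    have i2 : Integrable (fun ω => (-((θ * u) ^ 2 / 2 : ℂ)) * (E ω * ((ξ ω ^ 2 : ℝ) : ℂ))) P :=
      (hEi _ hξ2i.ofReal).const_mul _
    have i3 : Integrable (fun ω => θ * u * Complex.I * (E ω * (ξ ω : ℂ))
        + (-((θ * u) ^ 2 / 2 : ℂ)) * (E ω * ((ξ ω ^ 2 : ℝ) : ℂ))) P := i1.add i2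
    have i4 : Integrable (fun ω => E ω + (θ * u * Complex.I * (E ω * (ξ ω : ℂ))
        + (-((θ * u) ^ 2 / 2 : ℂ)) * (E ω * ((ξ ω ^ 2 : ℝ) : ℂ)))) P := hEE.add i3
    have hqE : Integrable (fun ω => E ω * (q n ω : ℂ)) P := hEi _ hqi.ofReal
    have e5 : ∫ ω, E ω * ((v - q n ω : ℝ) : ℂ) ∂P
        = (∫ ω, E ω ∂P) * v - ∫ ω, E ω * (q n ω : ℂ) ∂P := by
      rw [← integral_mul_const, ← integral_sub (hEE.mul_const _) hqE]
      refine integral_congr_ae (Eventually.of_forall fun ω => ?_)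
      push_cast
      ring
    simp only [e]
    rw [integral_add (hEi R hRi) i4, integral_add hEE i3, integral_add i1 i2, integral_const_mul,
      integral_const_mul, h1, h2, e5, ha]
    push_cast
    ring
  have hξb : ∀ᵐ ω ∂P, ‖R ω‖ ≤ 4 * (|θ| * C * u) ^ 3 := by
    filter_upwards [h.step_le n] with ω hω
    refine (norm_exp_mul_I_sub_le _).trans ?_
    rw [abs_mul, abs_mul, abs_of_pos hu0]
    have : |θ| * u * |ξ ω| ≤ |θ| * C * u := by
      calc |θ| * u * |ξ ω| ≤ |θ| * u * C := by gcongr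
        _ = _ := by ring
    gcongr
  have hC0 : 0 ≤ C := by
    obtain ⟨ω, hω⟩ := (h.step_le n).exists
    exact (abs_nonneg _).trans hω
  have b1 : ‖∫ ω, E ω * R ω ∂P‖ ≤ 4 * (|θ| * C * u) ^ 3 := by
    have := norm_integral_le_of_norm_le_const (μ := P) (f := fun ω => E ω * R ω)
      (hξb.mono fun ω hω => show ‖E ω * R ω‖ ≤ _ by rwa [norm_mul, hEn, one_mul])
    simpa using this
  have b2 : ‖((Real.exp (-a) - (1 - a) : ℝ) : ℂ) * ∫ ω, E ω ∂P‖ ≤ (|θ| * C * u) ^ 3 := by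
    have b3 : ‖∫ ω, E ω ∂P‖ ≤ 1 := by
      have := norm_integral_le_of_norm_le_const (μ := P) (f := E)
        (Eventually.of_forall fun ω => (hEn ω).le)
      simpa using this
    rw [norm_mul, Complex.norm_real, Real.norm_eq_abs]
    have hv0 : 0 ≤ v := h.integral_var_nonneg n
    have b4 : |Real.exp (-a) - (1 - a)| ≤ (|θ| * C * u) ^ 3 := by
      refine abs_exp_neg_sub_le (by positivity) (by positivity) ?_
      have := h.integral_var_le n
      calc a ≤ θ ^ 2 / 2 * (u ^ 2 * C ^ 2) := by rw [ha]; gcongr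
        _ ≤ θ ^ 2 * (u ^ 2 * C ^ 2) := by
          have : 0 ≤ θ ^ 2 * (u ^ 2 * C ^ 2) := by positivity
          linarith
        _ = _ := by rw [← sq_abs θ]; ring
    calc _ ≤ (|θ| * C * u) ^ 3 * 1 := mul_le_mul b4 b3 (norm_nonneg _) (by positivity)
      _ = _ := mul_one _
  have b5 : ‖((θ ^ 2 / 2 * u ^ 2 : ℝ) : ℂ) * ∫ ω, E ω * ((v - q n ω : ℝ) : ℂ) ∂P‖
      ≤ θ ^ 2 / 2 * (u ^ 2 * ∫ ω, |q n ω - v| ∂P) := by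
    rw [norm_mul, Complex.norm_real, Real.norm_eq_abs, abs_of_nonneg (by positivity), mul_assoc]
    refine mul_le_mul_of_nonneg_left (mul_le_mul_of_nonneg_left ?_ (by positivity)) (by positivity)
    refine (norm_integral_le_integral_norm _).trans (le_of_eq ?_)
    refine integral_congr_ae (Eventually.of_forall fun ω => ?_)
    simp only [norm_mul, hEn, one_mul, Complex.norm_real, Real.norm_eq_abs]
    exact abs_sub_comm _ _
  have hfin : 5 * (|θ| * C) ^ 3 * u ^ 3 = 4 * (|θ| * C * u) ^ 3 + (|θ| * C * u) ^ 3 := by ring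
  rw [hfin]
  refine (le_of_eq (congrArg norm hdecomp)).trans ?_
  refine (norm_add_le _ _).trans ?_
  linarith [norm_sub_le (∫ ω, E ω * R ω ∂P) (((Real.exp (-a) - (1 - a) : ℝ) : ℂ) * ∫ ω, E ω ∂P)]

end IsLinearRecursion

/-- The factors `exp (-a n)` are at most 1, so one-step errors add up without being amplified. -/
lemma norm_sub_exp_mul_le_sum {Φ : ℕ → ℂ} {a δ : ℕ → ℝ} (ha : ∀ n, 0 ≤ a n)
    (h : ∀ n, ‖Φ (n + 1) - Real.exp (-a n) * Φ n‖ ≤ δ n) (n : ℕ) :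
    ‖Φ n - Real.exp (-∑ j ∈ Finset.range n, a j) * Φ 0‖ ≤ ∑ j ∈ Finset.range n, δ j := by
  induction n with
  | zero => simp
  | succ n ih =>
    rw [Finset.sum_range_succ, Finset.sum_range_succ, neg_add_rev, Real.exp_add]
    have e : Φ (n + 1) - ((Real.exp (-a n) * Real.exp (-∑ j ∈ Finset.range n, a j) : ℝ) : ℂ) * Φ 0
        = (Φ (n + 1) - Real.exp (-a n) * Φ n)
          + Real.exp (-a n) * (Φ n - Real.exp (-∑ j ∈ Finset.range n, a j) * Φ 0) := by
      push_cast
      ring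
    rw [e]
    have h1 : ‖(Real.exp (-a n) : ℂ) * (Φ n - Real.exp (-∑ j ∈ Finset.range n, a j) * Φ 0)‖
        ≤ ∑ j ∈ Finset.range n, δ j := by
      rw [norm_mul, Complex.norm_real, Real.norm_eq_abs, abs_of_pos (Real.exp_pos _)]
      have : Real.exp (-a n) ≤ 1 := Real.exp_le_one_iff.2 (by linarith [ha n])
      exact (mul_le_of_le_one_left (norm_nonneg _) this).trans ih
    linarith [norm_add_le (Φ (n + 1) - Real.exp (-a n) * Φ n)
      (Real.exp (-a n) * (Φ n - Real.exp (-∑ j ∈ Finset.range n, a j) * Φ 0)), h n]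

namespace IsLinearRecursion

variable {Ω : Type*} [mΩ : MeasurableSpace Ω] {P : Measure Ω} [IsProbabilityMeasure P]
  {ℱ : Filtration ℕ mΩ} {g β : ℕ → ℝ} {C : ℝ} {Y q : ℕ → Ω → ℝ}

/-- A central limit theorem for linear recursions with asymptotically constant conditional
variances. -/
theorem tendstoInDistribution_div_sqrt (h : IsLinearRecursion P ℱ g C Y q) (hβ : ∀ n, 0 < β n)
    (hβg : ∀ n, β (n + 1) = β n * g n)
    (hS : Tendsto (fun n => ∑ j ∈ Finset.range n, ((β (j + 1))⁻¹) ^ 2) atTop atTop)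
    (hr : Tendsto (fun n => ((β (n + 1))⁻¹) ^ 2
      / ∑ j ∈ Finset.range (n + 1), ((β (j + 1))⁻¹) ^ 2) atTop (𝓝 0))
    {v : ℝ} (hv : 0 < v) (hq : Tendsto (fun n => ∫ ω, |q n ω - v| ∂P) atTop (𝓝 0)) :
    TendstoInDistribution (fun n ω => Y n ω / √(∫ ω', Y n ω' ^ 2 ∂P)) atTop (id : ℝ → ℝ)
      (fun _ => P) (gaussianReal 0 1) := by
  have hXm : ∀ n, Measurable (fun ω => Y n ω / √(∫ ω', Y n ω' ^ 2 ∂P)) := fun n =>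
    (h.measurable n).div_const _
  refine ⟨fun n => (hXm n).aemeasurable, by fun_prop, ?_⟩
  refine ProbabilityMeasure.tendsto_iff_tendsto_charFun.2 fun t => ?_
  set u : ℕ → ℝ := fun j => (β (j + 1))⁻¹ with hu
  have hu0 : ∀ j, 0 < u j := fun j => inv_pos.2 (hβ _)
  set S : ℕ → ℝ := fun n => ∑ j ∈ Finset.range n, u j ^ 2 with hSdef
  set vq : ℕ → ℝ := fun n => ∫ ω, q n ω ∂P with hvq
  set V : ℕ → ℝ := fun n => ∑ j ∈ Finset.range n, u j ^ 2 * vq j with hV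
  set s2 : ℕ → ℝ := fun n => (∫ ω, Y n ω ^ 2 ∂P) / β n ^ 2 with hs2
  have hs2V : ∀ n, s2 n = s2 0 + V n := fun n => h.integral_sq_div_eq hβ hβg n
  have hdist : ∀ n, |vq n - v| ≤ ∫ ω, |q n ω - v| ∂P := fun n => by
    have e : vq n - v = ∫ ω, (q n ω - v) ∂P := by
      rw [integral_sub (h.integrable_var n) (integrable_const v)]; simp [hvq]
    rw [e]
    exact abs_integral_le_integral_abs
  have hvq0 : Tendsto (fun n => vq n - v) atTop (𝓝 0) :=
    squeeze_zero_norm hdist hq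
  set e : ℕ → ℝ := fun n => ∫ ω, |q n ω - vq n| ∂P with he
  have he0 : Tendsto e atTop (𝓝 0) := by
    have h2 : Tendsto (fun n => 2 * ∫ ω, |q n ω - v| ∂P) atTop (𝓝 0) := by
      simpa using hq.const_mul 2
    refine tendsto_of_tendsto_of_tendsto_of_le_of_le tendsto_const_nhds h2
      (fun n => integral_nonneg fun ω => abs_nonneg _) fun n => ?_
    have hi : Integrable (fun ω => |q n ω - v|) P :=
      ((h.integrable_var n).sub (integrable_const v)).abs
    have hi2 : Integrable (fun ω => |q n ω - vq n|) P :=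
      ((h.integrable_var n).sub (integrable_const _)).abs
    calc e n ≤ ∫ ω, (|q n ω - v| + |vq n - v|) ∂P := by
          refine integral_mono hi2 (hi.add (integrable_const _)) fun ω => ?_
          have := abs_sub_le (q n ω) v (vq n)
          rw [abs_sub_comm v] at this
          exact this
      _ = ∫ ω, |q n ω - v| ∂P + |vq n - v| := by
          rw [integral_add hi (integrable_const _)]; simp
      _ ≤ _ := by linarith [hdist n]
  have hSpos : ∀ᶠ n in atTop, 0 < S n := hS.eventually_gt_atTop 0
  have hVS : Tendsto (fun n => V n / S n) atTop (𝓝 v) := by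
    have h1 := (tendsto_weighted_average (fun n => sq_nonneg (u n)) hS hvq0).add_const v
    rw [zero_add] at h1
    refine h1.congr' ?_
    filter_upwards [hSpos] with n hn
    have e : ∑ j ∈ Finset.range n, u j ^ 2 * (vq j - v) = V n - v * S n := by
      simp only [hV, hSdef, Finset.mul_sum, ← Finset.sum_sub_distrib]
      exact Finset.sum_congr rfl fun j _ => by ring
    change (∑ j ∈ Finset.range n, u j ^ 2 * (vq j - v)) / S n + v = V n / S n
    rw [e]
    field_simp
    ring
  have hsS : Tendsto (fun n => s2 n / S n) atTop (𝓝 v) := by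
    have h1 : Tendsto (fun n => s2 0 / S n) atTop (𝓝 0) := tendsto_const_nhds.div_atTop hS
    have h2 := h1.add hVS
    rw [zero_add] at h2
    refine h2.congr fun n => ?_
    rw [hs2V n, add_div]
  have hSs : Tendsto (fun n => S n / s2 n) atTop (𝓝 v⁻¹) := by
    simpa only [inv_div] using hsS.inv₀ hv.ne'
  have hVs : Tendsto (fun n => V n / s2 n) atTop (𝓝 1) := by
    have h1 := hVS.mul hSs
    rw [mul_inv_cancel₀ hv.ne'] at h1
    refine h1.congr' ?_
    filter_upwards [hSpos] with n hn
    rw [div_mul_div_cancel₀ hn.ne']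
  have hs0 : Tendsto (fun n => (s2 n)⁻¹) atTop (𝓝 0) := by
    have h1 := hSs.mul (tendsto_inv_atTop_zero.comp hS)
    rw [mul_zero] at h1
    refine h1.congr' ?_
    filter_upwards [hSpos] with n hn
    simp only [Function.comp_apply]
    field_simp
  have hs2nn : ∀ n, 0 ≤ s2 n := fun n =>
    div_nonneg (integral_nonneg fun ω => sq_nonneg _) (sq_nonneg _)
  -- The frequency depends on the final time `n`; the one-step comparison is run from 0 to `n` with
  -- this frequency fixed. Since it tends to 0, the law of `Y 0` has no influence in the limit.
  set θ : ℕ → ℝ := fun n => t * √((s2 n)⁻¹) with hθ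
  have hθ2 : ∀ n, θ n ^ 2 = t ^ 2 * (s2 n)⁻¹ := fun n => by
    rw [hθ, mul_pow, Real.sq_sqrt (inv_nonneg.2 (hs2nn n))]
  have hθ0 : Tendsto θ atTop (𝓝 0) := by
    have := hs0.sqrt.const_mul t
    rwa [Real.sqrt_zero, mul_zero] at this
  have hscale : ∀ n ω, t * (Y n ω / √(∫ ω', Y n ω' ^ 2 ∂P)) = θ n * (Y n ω / β n) := by
    intro n ω
    simp only [hθ, hs2]
    rw [inv_div, Real.sqrt_div (sq_nonneg _), Real.sqrt_sq (hβ n).le]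
    have := (hβ n).ne'
    field_simp
  set Φ : ℝ → ℕ → ℂ := fun θ n => ∫ ω, Complex.exp ((θ * (Y n ω / β n) : ℝ) * Complex.I) ∂P with hΦ
  have hchar : ∀ n, charFun (P.map (fun ω => Y n ω / √(∫ ω', Y n ω' ^ 2 ∂P))) t = Φ (θ n) n := by
    intro n
    rw [charFun_apply_real, integral_map (hXm n).aemeasurable (by fun_prop)]
    refine integral_congr_ae (Eventually.of_forall fun ω => ?_)
    dsimp only
    rw [← hscale]
    push_cast
    ring_nf
  have hgauss : charFun ((gaussianReal 0 1).map (id : ℝ → ℝ)) t = Real.exp (-(t ^ 2 / 2)) := by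
    rw [Measure.map_id, charFun_gaussianReal]
    push_cast
    congr 1
    simp
  change Tendsto (fun n => charFun (P.map (fun ω => Y n ω / √(∫ ω', Y n ω' ^ 2 ∂P))) t) atTop
    (𝓝 (charFun ((gaussianReal 0 1).map (id : ℝ → ℝ)) t))
  simp only [hchar, hgauss]
  have hbound : ∀ n, ‖Φ (θ n) n - Real.exp (-∑ j ∈ Finset.range n,
      θ n ^ 2 / 2 * (u j ^ 2 * vq j)) * Φ (θ n) 0‖ ≤ ∑ j ∈ Finset.range n,
        (θ n ^ 2 / 2 * (u j ^ 2 * e j) + 5 * (|θ n| * C) ^ 3 * u j ^ 3) := fun n =>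
    norm_sub_exp_mul_le_sum (fun j => by have := h.integral_var_nonneg j; positivity)
      (fun j => h.norm_integral_exp_step_le hβ hβg (θ n) j) n
  have hmain : Tendsto (fun n => (Real.exp (-∑ j ∈ Finset.range n,
      θ n ^ 2 / 2 * (u j ^ 2 * vq j)) : ℂ) * Φ (θ n) 0) atTop
      (𝓝 ((Real.exp (-(t ^ 2 / 2)) : ℂ) * 1)) := by
    refine Tendsto.mul ?_ ?_
    · have h1 : Tendsto (fun n => Real.exp (-(t ^ 2 / 2 * (V n / s2 n)))) atTop
          (𝓝 (Real.exp (-(t ^ 2 / 2)))) := by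
        have := (hVs.const_mul (t ^ 2 / 2)).neg.rexp
        rwa [mul_one] at this
      have h2 := (Complex.continuous_ofReal.tendsto _).comp h1
      refine h2.congr fun n => ?_
      simp only [Function.comp_apply]
      rw [← Finset.mul_sum, hθ2]
      congr 3
      simp only [hV]
      ring
    · have h1 : Tendsto (fun n => Φ (θ n) 0) atTop (𝓝 (∫ _, (1 : ℂ) ∂P)) := by
        refine tendsto_integral_of_dominated_convergence (fun _ => 1) (fun n => ?_)
          (integrable_const 1) (fun n => Eventually.of_forall fun ω => ?_)
          (Eventually.of_forall fun ω => ?_)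
        · have := h.measurable 0
          exact Measurable.aestronglyMeasurable (by fun_prop)
        · rw [Complex.norm_exp_ofReal_mul_I]
        · have h2 : Tendsto (fun n => θ n * (Y 0 ω / β 0)) atTop (𝓝 0) := by
            simpa using hθ0.mul_const (Y 0 ω / β 0)
          have h3 : Continuous fun y : ℝ => Complex.exp ((y : ℂ) * Complex.I) := by fun_prop
          simpa [Function.comp_def] using (h3.tendsto 0).comp h2
      simpa using h1
  have herr : Tendsto (fun n => ∑ j ∈ Finset.range n,
      (θ n ^ 2 / 2 * (u j ^ 2 * e j) + 5 * (|θ n| * C) ^ 3 * u j ^ 3)) atTop (𝓝 0) := by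
    have h1 := ((tendsto_weighted_average (fun n => sq_nonneg (u n)) hS he0).mul hSs).const_mul
      (t ^ 2 / 2)
    have h2 := ((tendsto_sum_cube_div hu0 hS hr).mul (hSs.sqrt.pow 3)).const_mul
      (5 * (|t| * C) ^ 3)
    have h3 := h1.add h2
    simp only [zero_mul, mul_zero, add_zero] at h3
    refine h3.congr' ?_
    filter_upwards [hSpos] with n hn
    have hn' : 0 < √(S n) := Real.sqrt_pos.2 hn
    rw [Finset.sum_add_distrib, ← Finset.mul_sum, ← Finset.mul_sum]
    change t ^ 2 / 2 * ((∑ j ∈ Finset.range n, u j ^ 2 * e j) / S n * (S n / s2 n))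
      + 5 * (|t| * C) ^ 3 * ((∑ j ∈ Finset.range n, u j ^ 3) / √(S n) ^ 3 * √(S n / s2 n) ^ 3) = _
    congr 1
    · rw [hθ2, div_mul_div_cancel₀ hn.ne']
      ring
    · rw [hθ, abs_mul, abs_of_nonneg (Real.sqrt_nonneg _), div_eq_mul_inv (S n),
        Real.sqrt_mul hn.le]
      field_simp
  have hdiff := squeeze_zero_norm hbound herr
  have := hdiff.add hmain
  simpa using this

end IsLinearRecursion

/-! ### Restarting the recursion and growth of second moments. -/

section

variable {Ω : Type*} [mΩ : MeasurableSpace Ω] {P : Measure Ω}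
  {ℱ : Filtration ℕ mΩ} {g : ℕ → ℝ} {C : ℝ} {Y q : ℕ → Ω → ℝ}

/-- The filtration `ℱ`, started at time `k`. -/
def shiftFiltration (ℱ : Filtration ℕ mΩ) (k : ℕ) : Filtration ℕ mΩ where
  seq n := ℱ (n + k)
  mono' _ _ hij := ℱ.mono (Nat.add_le_add_right hij k)
  le' _ := ℱ.le _

lemma IsLinearRecursion.shift (h : IsLinearRecursion P ℱ g C Y q) (k : ℕ) :
    IsLinearRecursion P (shiftFiltration ℱ k) (fun n => g (n + k)) C (fun n => Y (n + k))
      (fun n => q (n + k)) := by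
  refine ⟨fun n => h.stronglyMeasurable _, fun n => h.stronglyMeasurable_var _,
    fun n => h.bounded _, fun n => ?_, fun n => h.var_nonneg _, fun n => h.var_le _,
    fun n => ?_, fun n => ?_⟩ <;> simp only [add_right_comm n 1 k]
  · exact h.step_le _
  · exact h.integral_mul_step (n + k)
  · exact h.integral_mul_step_sq (n + k)

variable [IsProbabilityMeasure P]

lemma integral_abs_le_sqrt {f : Ω → ℝ} (hf : Measurable f) (hb : ∃ B, ∀ ω, |f ω| ≤ B) :
    ∫ ω, |f ω| ∂P ≤ √(∫ ω, f ω ^ 2 ∂P) := by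
  have h1 : Integrable (fun ω => |f ω|) P := (integrable_of_forall_abs_le hf hb).abs
  have h2 : Integrable (fun ω => f ω ^ 2) P := by
    obtain ⟨B, hB⟩ := hb
    refine integrable_of_forall_abs_le (hf.pow_const 2) ⟨B ^ 2, fun ω => ?_⟩
    have := hB ω
    rw [abs_pow]; gcongr
  set c := ∫ ω, |f ω| ∂P with hc
  refine Real.le_sqrt_of_sq_le ?_
  have h3 : 0 ≤ ∫ ω, (|f ω| - c) ^ 2 ∂P := integral_nonneg fun ω => sq_nonneg _
  have e : ∀ ω, (|f ω| - c) ^ 2 = f ω ^ 2 - (2 * c * |f ω| - c ^ 2) := fun ω => by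
    rw [← sq_abs (f ω)]; ring
  simp only [e] at h3
  have hi : Integrable (fun ω => 2 * c * |f ω| - c ^ 2) P :=
    (h1.const_mul _).sub (integrable_const _)
  rw [integral_sub h2 hi,
    integral_sub (h1.const_mul _) (integrable_const _), integral_const_mul] at h3
  simp only [integral_const, probReal_univ, smul_eq_mul, one_mul, ← hc] at h3
  nlinarith

/-- A crude bound, `o(n ^ 2)`, is enough to make proportions converge; the exponent 3/2 leaves room
for the critical case `l = 1/2`. -/
lemma IsLinearRecursion.exists_integral_sq_le (h : IsLinearRecursion P ℱ g C Y q) {x l : ℝ}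
    (hx : 1 ≤ x) (hxl : 0 < x + l) (hl : l ≤ 1 / 2) (hg : ∀ n : ℕ, g n = 1 + l / (n + x)) :
    ∃ A : ℝ, ∀ n : ℕ, ∫ ω, Y n ω ^ 2 ∂P ≤ A * ((n : ℝ) + x) ^ (3 / 2 : ℝ) := by
  set A := max (4 * C ^ 2) (∫ ω, Y 0 ω ^ 2 ∂P) with hA
  have hA0 : 0 ≤ A := le_max_of_le_left (by positivity)
  refine ⟨A, fun n => ?_⟩
  induction n with
  | zero =>
    have h1 : 1 ≤ ((0 : ℕ) + x : ℝ) ^ (3 / 2 : ℝ) :=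
      Real.one_le_rpow (by simpa using hx) (by norm_num)
    exact (le_max_right _ _).trans (le_mul_of_one_le_right hA0 h1)
  | succ n ih =>
    have hu1 : (1 : ℝ) ≤ n + x := by linarith [(Nat.cast_nonneg n : (0 : ℝ) ≤ n)]
    set s : ℝ := (n : ℝ) + x with hs
    have hs0 : 0 < s := by linarith
    have hg0 : 0 ≤ g n := by rw [hg]; exact (one_add_div_pos (by linarith) hxl n).le
    have hg1 : g n ^ 2 ≤ 1 + 5 / 4 * (1 / s) := by
      have h1 : g n ≤ 1 + 1 / 2 * (1 / s) := by
        rw [hg, mul_one_div]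
        gcongr
      have h2 : 1 / s ≤ 1 := by rw [div_le_one hs0]; exact hu1
      have h3 : 0 ≤ 1 / s := by positivity
      calc g n ^ 2 ≤ (1 + 1 / 2 * (1 / s)) ^ 2 := by gcongr
        _ ≤ _ := by nlinarith
    have hbern : s ^ (3 / 2 : ℝ) * (1 + 3 / 2 * (1 / s)) ≤ (s + 1) ^ (3 / 2 : ℝ) := by
      have h1 := one_add_mul_self_le_rpow_one_add (s := 1 / s) (p := 3 / 2)
        (by have : 0 ≤ 1 / s := by positivity
            linarith) (by norm_num)
      have h2 : s + 1 = s * (1 + 1 / s) := by field_simp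
      rw [h2, Real.mul_rpow hs0.le (by positivity)]
      gcongr
    -- The exponent gap `3/2 - 5/4 = 1/4` yields a surplus of at least `A / 4`, which absorbs the
    -- new variance since `A ≥ 4 C ^ 2`.
    have hs32 : 1 ≤ s ^ (3 / 2 : ℝ) * (1 / s) := by
      rw [mul_one_div, le_div_iff₀ hs0, one_mul]
      exact Real.self_le_rpow_of_one_le hu1 (by norm_num)
    rw [h.integral_sq_succ]
    have e : (((n + 1 : ℕ) : ℝ) + x) = s + 1 := by rw [hs]; push_cast; ring
    rw [e]
    have h4 : 4 * C ^ 2 ≤ A := le_max_left _ _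
    have h5 := h.integral_var_le n
    have h6 : 0 ≤ s ^ (3 / 2 : ℝ) := by positivity
    have h7 : g n ^ 2 * ∫ ω, Y n ω ^ 2 ∂P ≤ (1 + 5 / 4 * (1 / s)) * (A * s ^ (3 / 2 : ℝ)) :=
      mul_le_mul hg1 ih (integral_nonneg fun ω => sq_nonneg _) (by positivity)
    have h8 := mul_le_mul_of_nonneg_left hbern hA0
    have h9 := mul_le_mul_of_nonneg_left hs32 hA0
    nlinarith

end

/-! ### Urns with positive index: large-index and triangular cases. -/

namespace BalancedUrn

variable {U : BalancedUrn} {S : SamplingModel} {Ω : Type*} [mΩ : MeasurableSpace Ω]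
  {P : Measure Ω} [IsProbabilityMeasure P] {K : ℕ → Ω → Fin (U.m + 1)}

lemma growth_eq (U : BalancedUrn) (n : ℕ) :
    U.growth n = 1 + U.index / (n + (U.total 0 : ℝ) / U.σ) := by
  have h1 : (0 : ℝ) < U.σ := by exact_mod_cast U.one_le_σ
  have h2 : (0 : ℝ) < U.total n := by exact_mod_cast U.total_pos n
  have h3 : (U.total n : ℝ) = U.total 0 + U.σ * n := by unfold total; push_cast; ring
  have h4 : (n : ℝ) + (U.total 0 : ℝ) / U.σ = U.total n / U.σ := by rw [h3]; field_simp; ring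
  rw [growth, index, h4, slope]
  field_simp

lemma total_div_pos (U : BalancedUrn) : 0 < (U.total 0 : ℝ) / U.σ :=
  div_pos (by exact_mod_cast U.total_pos 0) (by exact_mod_cast U.one_le_σ)

/-- The balance condition for an all-white sample, with the affine form of `a 0` inserted. It shows
that `T_n` solves the mean recursion when `b_0 = 0`, and a multiple of `T_n` does in general. -/
lemma IsAffine.a_zero_add_b_zero (haff : U.IsAffine S) :
    (U.a U.m : ℝ) + U.m * U.slope + U.b 0 = U.σ := by
  have h1 := haff.a_eq U.m le_rfl
  have h2 : (U.a 0 : ℝ) + U.b 0 = U.σ := by exact_mod_cast U.balanced 0 (Nat.zero_le _)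
  rw [Nat.sub_self] at h1
  rw [← h2, h1, slope]
  ring

lemma integrable_white (hK : U.IsDrawSequence S P K) (n : ℕ) :
    Integrable (fun ω => (U.white K n ω : ℝ)) P :=
  integrable_of_forall_abs_le
    (((U.measurable_comp_white_black K (fun w _ => (w : ℝ)) n)).mono
      ((U.drawFiltration K hK.measurable).le n) le_rfl) (U.exists_abs_white_le K n)

lemma IsDrawSequence.integral_white_succ (hK : U.IsDrawSequence S P K) (hten : U.IsTenable S)
    (haff : U.IsAffine S) (n : ℕ) :
    ∫ ω, (U.white K (n + 1) ω : ℝ) ∂P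
      = U.growth n * ∫ ω, (U.white K n ω : ℝ) ∂P + U.a U.m := by
  -- Any solution of the recursion will do here; testing the innovations against 1 then transfers
  -- the recursion to the mean.
  set c : ℕ → ℝ := fun n => Nat.rec 0 (fun n y => U.growth n * y + U.a U.m) n with hc
  have h := hK.isLinearRecursion hten haff c fun n => rfl
  have h1 := h.integral_mul_step n (fun _ => 1) stronglyMeasurable_const ⟨1, by simp⟩
  simp only [one_mul] at h1
  have hcs : c (n + 1) = U.growth n * c n + U.a U.m := rfl
  rw [integral_sub (h.integrable _) ((h.integrable n).const_mul _), integral_const_mul,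
    integral_sub (integrable_white hK _) (integrable_const _),
    integral_sub (integrable_white hK _) (integrable_const _)] at h1
  simp only [integral_const, probReal_univ, smul_eq_mul, one_mul] at h1
  rw [hcs] at h1
  linarith

lemma IsDrawSequence.isLinearRecursion_centred (hK : U.IsDrawSequence S P K)
    (hten : U.IsTenable S) (haff : U.IsAffine S) :
    IsLinearRecursion P (U.drawFiltration K hK.measurable) U.growth (|U.slope| * U.m)
      (fun n ω => (U.white K n ω : ℝ) - ∫ ω', (U.white K n ω' : ℝ) ∂P) (U.stepVar S K) :=
  hK.isLinearRecursion hten haff _ (hK.integral_white_succ hten haff)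

lemma IsDrawSequence.isLinearRecursion_white (hK : U.IsDrawSequence S P K)
    (hten : U.IsTenable S) (haff : U.IsAffine S) (ha : U.a U.m = 0) :
    IsLinearRecursion P (U.drawFiltration K hK.measurable) U.growth (|U.slope| * U.m)
      (fun n ω => (U.white K n ω : ℝ)) (U.stepVar S K) := by
  simpa using hK.isLinearRecursion hten haff (fun _ => 0) (by simp [ha])

lemma IsDrawSequence.isLinearRecursion_black (hK : U.IsDrawSequence S P K)
    (hten : U.IsTenable S) (haff : U.IsAffine S) (hb : U.b 0 = 0) :
    IsLinearRecursion P (U.drawFiltration K hK.measurable) U.growth (|U.slope| * U.m)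
      (fun n ω => (U.black K n ω : ℝ)) (U.stepVar S K) := by
  have h := (hK.isLinearRecursion hten haff (fun n => (U.total n : ℝ)) fun n => by
    have h1 := haff.a_zero_add_b_zero
    have h2 : (0 : ℝ) < U.total n := by exact_mod_cast U.total_pos n
    rw [total_succ, growth, Nat.cast_add, ← h1, hb]
    field_simp
    push_cast
    ring).neg
  have e : (fun (n : ℕ) (ω : Ω) => -((U.white K n ω : ℝ) - U.total n))
      = fun n ω => (U.black K n ω : ℝ) := by
    funext n ω
    have : (U.white K n ω : ℝ) + U.black K n ω = U.total n := by
      exact_mod_cast U.white_add_black K n ω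
    linarith
  rwa [e] at h

section IndexPos

variable {ℱ : Filtration ℕ mΩ} {C : ℝ} {Y q : ℕ → Ω → ℝ}

lemma exists_convergesWithMoments_of_summable (h : IsLinearRecursion P ℱ U.growth C Y q)
    (hC : 0 ≤ C) (hΛ : 0 < U.index) {ε : ℕ → ℝ} (hε : Summable ε) (hε0 : ∀ n, 0 ≤ ε n)
    (hq : ∀ n, ∀ᵐ ω ∂P,
      q n ω / growthProd ((U.total 0 : ℝ) / U.σ) U.index (n + 1) ^ 2
        ≤ ε n * (1 + (Y n ω / growthProd ((U.total 0 : ℝ) / U.σ) U.index n) ^ 2)) :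
    ∃ Z, ConvergesWithMoments P (fun n ω => Y n ω / (n : ℝ) ^ U.index) Z := by
  have hx := U.total_div_pos
  have hxl : 0 < (U.total 0 : ℝ) / U.σ + U.index := by positivity
  obtain ⟨A, B, hA, -, hAB⟩ := exists_growthProd_bounds hx hxl
  obtain ⟨c, -, hc, -⟩ := exists_tendsto_growthProd hx hxl
  refine h.exists_convergesWithMoments (D := C / A) (growthProd_pos hx hxl)
    (fun n => by rw [growthProd_succ, growth_eq]) (fun n => ?_) hε hε0 hq hc
  have h1 : (1 : ℝ) ≤ (((n + 1 : ℕ) : ℝ) + 1) ^ U.index :=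
    Real.one_le_rpow (by push_cast; linarith [(Nat.cast_nonneg n : (0 : ℝ) ≤ n)]) hΛ.le
  have h2 := (hAB (n + 1)).1
  exact div_le_div_of_nonneg_left hC hA ((le_mul_of_one_le_right hA.le h1).trans h2)

lemma exists_convergesWithMoments_of_half_lt (h : IsLinearRecursion P ℱ U.growth C Y q)
    (hC : 0 ≤ C) (hΛ : 1 / 2 < U.index) :
    ∃ Z, ConvergesWithMoments P (fun n ω => Y n ω / (n : ℝ) ^ U.index) Z := by
  have hΛ0 : 0 < U.index := by linarith
  have hx := U.total_div_pos
  have hxl : 0 < (U.total 0 : ℝ) / U.σ + U.index := by positivity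
  obtain ⟨A, B, hA, -, hAB⟩ := exists_growthProd_bounds hx hxl
  have hpos := growthProd_pos hx hxl
  refine exists_convergesWithMoments_of_summable h hC hΛ0
    (ε := fun n => C ^ 2 / growthProd ((U.total 0 : ℝ) / U.σ) U.index (n + 1) ^ 2) ?_
    (fun n => by positivity) fun n => ?_
  · have h1 : Summable fun n : ℕ => 1 / (n : ℝ) ^ (2 * U.index) :=
      Real.summable_one_div_nat_rpow.2 (by linarith)
    refine Summable.of_nonneg_of_le (fun n => by positivity) (fun n => ?_)
      (((summable_nat_add_iff 2).2 h1).mul_left (C ^ 2 / A ^ 2))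
    have h2 := (hAB (n + 1)).1
    have h3 : (((n + 1 : ℕ) : ℝ) + 1) = ((n + 2 : ℕ) : ℝ) := by push_cast; ring
    rw [h3] at h2
    have h4 : (0 : ℝ) < ((n + 2 : ℕ) : ℝ) := by positivity
    have h5 : 0 < ((n + 2 : ℕ) : ℝ) ^ U.index := Real.rpow_pos_of_pos h4 _
    rw [mul_comm 2 U.index, Real.rpow_mul h4.le, Real.rpow_two, div_mul_div_comm, mul_one, ← mul_pow]
    gcongr
  · filter_upwards [h.var_le n] with ω hω
    have h1 := hpos (n + 1)
    calc _ ≤ C ^ 2 / growthProd ((U.total 0 : ℝ) / U.σ) U.index (n + 1) ^ 2 := by gcongr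
      _ ≤ _ := le_mul_of_one_le_right (by positivity) (le_add_of_nonneg_right (sq_nonneg _))

/-- Since `Y n = M n * β n` and `β` is increasing, the scaled variance is at most `C ^ 2 * M n / ((n
+ 1) * β (n + 1))`. With `M ≤ 1 + M ^ 2` and the lower bound on `β`, this is summable of order `n ^
(-1 - Λ)`. -/
lemma exists_convergesWithMoments_of_var_le (h : IsLinearRecursion P ℱ U.growth C Y q)
    (hC : 0 ≤ C) (hΛ : 0 < U.index)
    (hq : ∀ n, ∀ᵐ ω ∂P, 0 ≤ Y n ω ∧ q n ω ≤ C ^ 2 * (Y n ω / U.total n)) :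
    ∃ Z, ConvergesWithMoments P (fun n ω => Y n ω / (n : ℝ) ^ U.index) Z := by
  have hx := U.total_div_pos
  have hxl : 0 < (U.total 0 : ℝ) / U.σ + U.index := by positivity
  obtain ⟨A, B, hA, -, hAB⟩ := exists_growthProd_bounds hx hxl
  have hpos := growthProd_pos hx hxl
  refine exists_convergesWithMoments_of_summable h hC hΛ
    (ε := fun n => C ^ 2 / A * (1 / ((n + 1 : ℕ) : ℝ) ^ (1 + U.index))) ?_
    (fun n => by positivity) fun n => ?_
  · have h1 : Summable fun n : ℕ => 1 / (n : ℝ) ^ (1 + U.index) :=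
      Real.summable_one_div_nat_rpow.2 (by linarith)
    exact ((summable_nat_add_iff 1).2 h1).mul_left _
  · filter_upwards [hq n] with ω ⟨hY, hω⟩
    set β := growthProd ((U.total 0 : ℝ) / U.σ) U.index with hβ
    have h1 := hpos (n + 1)
    have h0 := hpos n
    have hn : (0 : ℝ) < ((n + 1 : ℕ) : ℝ) := by positivity
    have hnl : 0 < ((n + 1 : ℕ) : ℝ) ^ U.index := Real.rpow_pos_of_pos hn _
    have hT : ((n + 1 : ℕ) : ℝ) ≤ U.total n := by
      have h2 : n + 1 ≤ U.total n := by
        have h3 := U.total_pos 0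
        have h4 : 1 * n ≤ U.σ * n := Nat.mul_le_mul_right n U.one_le_σ
        simp only [total] at *
        omega
      exact_mod_cast h2
    have hmono : β n ≤ β (n + 1) := by
      rw [hβ, growthProd_succ]
      refine le_mul_of_one_le_right (hpos n).le ?_
      have : 0 ≤ U.index / (n + (U.total 0 : ℝ) / U.σ) := by positivity
      linarith
    have hlow : A * ((n + 1 : ℕ) : ℝ) ^ U.index ≤ β (n + 1) := by
      refine le_trans ?_ (hAB (n + 1)).1
      gcongr
      linarith
    have hM0 : 0 ≤ Y n ω / β n := div_nonneg hY h0.le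
    have hM : Y n ω / β n ≤ 1 + (Y n ω / β n) ^ 2 := by nlinarith [sq_nonneg (Y n ω / β n - 1)]
    have hYM : Y n ω = Y n ω / β n * β n := by field_simp
    calc q n ω / β (n + 1) ^ 2 ≤ C ^ 2 * (Y n ω / U.total n) / β (n + 1) ^ 2 := by gcongr
      _ ≤ C ^ 2 * (Y n ω / ((n + 1 : ℕ) : ℝ)) / β (n + 1) ^ 2 := by gcongr
      _ = C ^ 2 * (Y n ω / β n * β n / ((n + 1 : ℕ) : ℝ)) / β (n + 1) ^ 2 := by rw [← hYM]
      _ ≤ C ^ 2 * (Y n ω / β n * β (n + 1) / ((n + 1 : ℕ) : ℝ)) / β (n + 1) ^ 2 := by gcongr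
      _ = C ^ 2 * (Y n ω / β n) / ((n + 1 : ℕ) : ℝ) / β (n + 1) := by field_simp
      _ ≤ C ^ 2 * (1 + (Y n ω / β n) ^ 2) / ((n + 1 : ℕ) : ℝ)
          / (A * ((n + 1 : ℕ) : ℝ) ^ U.index) := by gcongr
      _ = _ := by
        rw [Real.rpow_add hn, Real.rpow_one]
        field_simp

end IndexPos

lemma IsDrawSequence.stepVar_le_white (hK : U.IsDrawSequence S P K) (hten : U.IsTenable S)
    (n : ℕ) : ∀ᵐ ω ∂P, 0 ≤ (U.white K n ω : ℝ) ∧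
      U.stepVar S K n ω ≤ (|U.slope| * U.m) ^ 2 * (U.white K n ω / U.total n) := by
  filter_upwards [hK.ae_exists_nat hten n] with ω ⟨w, b, hw, hb, hwb⟩
  have hT : (w : ℝ) + b = U.total n := by exact_mod_cast hwb
  refine ⟨by rw [hw]; positivity, ?_⟩
  have := S.drawVar_le_left (hwb ▸ U.m_le_total n : U.m ≤ w + b) (hwb ▸ U.total_pos n)
  rw [stepVar, hw, hb, mul_pow, sq_abs, mul_assoc, ← hT]
  exact mul_le_mul_of_nonneg_left this (sq_nonneg _)

lemma IsDrawSequence.stepVar_le_black (hK : U.IsDrawSequence S P K) (hten : U.IsTenable S)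
    (n : ℕ) : ∀ᵐ ω ∂P, 0 ≤ (U.black K n ω : ℝ) ∧
      U.stepVar S K n ω ≤ (|U.slope| * U.m) ^ 2 * (U.black K n ω / U.total n) := by
  filter_upwards [hK.ae_exists_nat hten n] with ω ⟨w, b, hw, hb, hwb⟩
  have hT : (w : ℝ) + b = U.total n := by exact_mod_cast hwb
  refine ⟨by rw [hb]; positivity, ?_⟩
  have := S.drawVar_le_right (hwb ▸ U.m_le_total n : U.m ≤ w + b) (hwb ▸ U.total_pos n)
  rw [stepVar, hw, hb, mul_pow, sq_abs, mul_assoc, ← hT]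
  exact mul_le_mul_of_nonneg_left this (sq_nonneg _)

end BalancedUrn

/-! ### Small-index urns. -/

namespace BalancedUrn

variable {U : BalancedUrn} {S : SamplingModel} {Ω : Type*} [mΩ : MeasurableSpace Ω]
  {P : Measure Ω} [IsProbabilityMeasure P] {K : ℕ → Ω → Fin (U.m + 1)}

/-- Up to `O(1 / T_n)` the sample variance is `m p (1 - p)`, and `p (1 - p)` is 1-Lipschitz on the
unit interval. -/
lemma IsDrawSequence.abs_stepVar_sub_le (hK : U.IsDrawSequence S P K) (hten : U.IsTenable S)
    {y : ℝ} (hy0 : 0 ≤ y) (hy1 : y ≤ 1) (n : ℕ) :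
    ∀ᵐ ω ∂P, |U.stepVar S K n ω - U.slope ^ 2 * (U.m * y * (1 - y))|
      ≤ U.slope ^ 2 * (U.m ^ 2 / U.total n
        + U.m * (|(U.white K n ω : ℝ) - y * U.total n| / U.total n)) := by
  filter_upwards [hK.ae_exists_nat hten n] with ω ⟨w, b, hw, hb, hwb⟩
  have hT : (w : ℝ) + b = U.total n := by exact_mod_cast hwb
  have hT0 : (0 : ℝ) < U.total n := by exact_mod_cast U.total_pos n
  have h1 := S.abs_drawVar_sub_le (hwb ▸ U.m_le_total n : U.m ≤ w + b) (hwb ▸ U.total_pos n)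
  rw [hT] at h1
  rw [stepVar, hw, hb, ← mul_sub, abs_mul, abs_of_nonneg (sq_nonneg U.slope)]
  refine mul_le_mul_of_nonneg_left ?_ (sq_nonneg _)
  simp only [Int.toNat_natCast, Int.cast_natCast]
  set p : ℝ := w / U.total n with hp
  have hp0 : 0 ≤ p := by positivity
  have hp1 : p ≤ 1 := by
    rw [hp, div_le_one hT0, ← hT]
    linarith [(Nat.cast_nonneg b : (0 : ℝ) ≤ b)]
  have h2 : |(w : ℝ) - y * U.total n| / U.total n = |p - y| := by
    rw [← abs_of_pos hT0, ← abs_div, abs_of_pos hT0, sub_div, mul_div_cancel_right₀ _ hT0.ne']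
  have h3 : |U.m * p * (1 - p) - U.m * y * (1 - y)| ≤ U.m * |p - y| := by
    have e : U.m * p * (1 - p) - U.m * y * (1 - y) = U.m * ((p - y) * (1 - p - y)) := by ring
    rw [e, abs_mul, Nat.abs_cast, abs_mul]
    refine mul_le_mul_of_nonneg_left (mul_le_of_le_one_right (abs_nonneg _) ?_) (Nat.cast_nonneg _)
    rw [abs_le]
    constructor <;> linarith
  rw [h2]
  exact (abs_sub_le _ (U.m * p * (1 - p)) _).trans (add_le_add h1 h3)

/-- The limiting proportion of white balls of a small-index urn. -/
noncomputable def limitProportion (U : BalancedUrn) : ℝ := U.a U.m / ((U.a U.m : ℝ) + U.b 0)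

lemma IsAffine.limitProportion_recursion (haff : U.IsAffine S) (ha : 0 < U.a U.m)
    (hb : 0 < U.b 0) (n : ℕ) :
    U.limitProportion * U.total (n + 1)
      = U.growth n * (U.limitProportion * U.total n) + U.a U.m := by
  have h1 := haff.a_zero_add_b_zero
  have h2 : (0 : ℝ) < U.total n := by exact_mod_cast U.total_pos n
  have ha' : (0 : ℝ) < U.a U.m := by exact_mod_cast ha
  have hb' : (0 : ℝ) < U.b 0 := by exact_mod_cast hb
  have h3 : U.limitProportion * ((U.a U.m : ℝ) + U.b 0) = U.a U.m := by
    unfold limitProportion; field_simp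
  rw [total_succ, growth, Nat.cast_add]
  have h4 : (1 + U.m * U.slope / U.total n) * (U.limitProportion * U.total n)
      = U.limitProportion * U.total n + U.limitProportion * (U.m * U.slope) := by
    field_simp
  rw [h4]
  nlinarith

/-- Centering at the limit proportion times `T_n`, rather than at the mean, gives a linear recursion
whose second moment is `O(n ^ (3/2))`; divided by `T_n ^ 2` it tends to 0. -/
lemma IsDrawSequence.tendsto_integral_abs_stepVar_sub (hK : U.IsDrawSequence S P K)
    (hten : U.IsTenable S) (haff : U.IsAffine S) (ha : 0 < U.a U.m) (hb : 0 < U.b 0)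
    (hΛ : U.index ≤ 1 / 2) {k : ℕ} (hk1 : 1 ≤ (U.total 0 : ℝ) / U.σ + k)
    (hk2 : 0 < (U.total 0 : ℝ) / U.σ + k + U.index) :
    Tendsto (fun n => ∫ ω, |U.stepVar S K (n + k) ω - U.slope ^ 2 *
      (U.m * U.limitProportion * (1 - U.limitProportion))| ∂P) atTop (𝓝 0) := by
  have ha' : (0 : ℝ) < U.a U.m := by exact_mod_cast ha
  have hb' : (0 : ℝ) < U.b 0 := by exact_mod_cast hb
  have hy0 : 0 ≤ U.limitProportion := by unfold limitProportion; positivity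
  have hy1 : U.limitProportion ≤ 1 := by
    unfold limitProportion
    rw [div_le_one (by positivity)]
    linarith
  set y := U.limitProportion with hy
  have hσ : (0 : ℝ) < U.σ := by exact_mod_cast U.one_le_σ
  have h := hK.isLinearRecursion hten haff (fun n => y * U.total n)
    (haff.limitProportion_recursion ha hb)
  set x : ℝ := (U.total 0 : ℝ) / U.σ + k with hx
  have hT : ∀ n : ℕ, (U.total (n + k) : ℝ) = U.σ * (n + x) := fun n => by
    have : (U.total (n + k) : ℝ) = U.total 0 + U.σ * (n + k) := by unfold total; push_cast; ring
    rw [this, hx]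
    field_simp
    ring
  obtain ⟨A, hA⟩ := (h.shift k).exists_integral_sq_le hk1 hk2 hΛ fun n => by
    rw [growth_eq, hx]
    push_cast
    ring_nf
  have hu : Tendsto (fun n : ℕ => (n : ℝ) + x) atTop atTop :=
    tendsto_atTop_add_const_right _ _ tendsto_natCast_atTop_atTop
  have hupos : ∀ n : ℕ, (0 : ℝ) < n + x := fun n => by positivity
  have hbound : ∀ n : ℕ, ∫ ω, |U.stepVar S K (n + k) ω - U.slope ^ 2 * (U.m * y * (1 - y))| ∂P
      ≤ U.slope ^ 2 * (U.m ^ 2 / (U.σ * (n + x)) +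
        U.m * (√(A * ((n : ℝ) + x) ^ (-(1 / 2) : ℝ)) / U.σ)) := by
    intro n
    have hi := (h.integrable (n + k)).abs
    have hi1 : Integrable (fun ω => |U.stepVar S K (n + k) ω
        - U.slope ^ 2 * (U.m * y * (1 - y))|) P :=
      ((h.integrable_var (n + k)).sub (integrable_const _)).abs
    have hi2 : Integrable (fun ω => U.m * (|(U.white K (n + k) ω : ℝ) - y * U.total (n + k)|
        / U.total (n + k))) P := (hi.div_const _).const_mul _
    have hi3 : Integrable (fun ω => (U.m : ℝ) ^ 2 / U.total (n + k)
        + U.m * (|(U.white K (n + k) ω : ℝ) - y * U.total (n + k)| / U.total (n + k))) P :=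
      (integrable_const _).add hi2
    have h1 := integral_mono_ae hi1 (hi3.const_mul _)
      (hK.abs_stepVar_sub_le hten hy0 hy1 (n + k))
    refine h1.trans ?_
    rw [integral_const_mul, integral_add (integrable_const _) hi2, integral_const_mul]
    simp only [integral_const, probReal_univ, smul_eq_mul, one_mul]
    refine mul_le_mul_of_nonneg_left ?_ (sq_nonneg _)
    have h2 := integral_abs_le_sqrt (P := P) (h.measurable (n + k)) (h.bounded (n + k))
    have h3 : √(∫ ω, ((U.white K (n + k) ω : ℝ) - y * U.total (n + k)) ^ 2 ∂P) / (n + x)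
        ≤ √(A * ((n : ℝ) + x) ^ (-(1 / 2) : ℝ)) := by
      have e : A * ((n : ℝ) + x) ^ (-(1 / 2) : ℝ)
          = A * ((n : ℝ) + x) ^ (3 / 2 : ℝ) / ((n : ℝ) + x) ^ 2 := by
        rw [mul_div_assoc, ← Real.rpow_natCast ((n : ℝ) + x) 2, ← Real.rpow_sub (hupos n)]
        norm_num
      rw [e, Real.sqrt_div' _ (sq_nonneg _), Real.sqrt_sq (hupos n).le]
      have := hupos n
      gcongr
      exact hA n
    rw [hT] at *
    refine add_le_add le_rfl (mul_le_mul_of_nonneg_left ?_ (Nat.cast_nonneg _))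
    rw [integral_div, div_mul_eq_div_div_swap]
    refine div_le_div_of_nonneg_right (le_trans ?_ h3) hσ.le
    exact div_le_div_of_nonneg_right h2 (hupos n).le
  refine squeeze_zero (fun n => integral_nonneg fun ω => abs_nonneg _) hbound ?_
  have t1 : Tendsto (fun n : ℕ => (U.m : ℝ) ^ 2 / (U.σ * (n + x))) atTop (𝓝 0) :=
    tendsto_const_nhds.div_atTop (hu.const_mul_atTop hσ)
  have t2 : Tendsto (fun n : ℕ => √(A * ((n : ℝ) + x) ^ (-(1 / 2) : ℝ))) atTop (𝓝 0) := by
    have := (((tendsto_rpow_neg_atTop (y := 1 / 2) (by norm_num)).comp hu).const_mul A).sqrt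
    simpa [Function.comp_def] using this
  have t3 := (t1.add ((t2.div_const (U.σ : ℝ)).const_mul (U.m : ℝ))).const_mul (U.slope ^ 2)
  simpa using t3

theorem IsDrawSequence.tendstoInDistribution_white (hK : U.IsDrawSequence S P K)
    (hten : U.IsTenable S) (haff : U.IsAffine S) (ha : U.a U.m ≠ 0) (hb : U.b 0 ≠ 0)
    (hΛ0 : U.index ≠ 0) (hΛ : U.index ≤ 1 / 2) :
    TendstoInDistribution
      (fun (n : ℕ) (ω : Ω) =>
        ((U.white K n ω : ℝ) - ∫ ω', (U.white K n ω' : ℝ) ∂P)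
          / √(variance (fun ω' => (U.white K n ω' : ℝ)) P))
      atTop (id : ℝ → ℝ) (fun _ => P) (gaussianReal 0 1) := by
  obtain ⟨ha, hb⟩ := hten.pos_and_pos ha hb
  have ha' : (0 : ℝ) < U.a U.m := by exact_mod_cast ha
  have hb' : (0 : ℝ) < U.b 0 := by exact_mod_cast hb
  -- For negative index the first growth factors may be zero or negative. Starting at time `k` makes
  -- all later ones positive and ensures the offset is at least 1.
  obtain ⟨k, hk⟩ := exists_nat_ge (1 + |U.index|)
  have hx0 := U.total_div_pos
  have hk1 : 1 ≤ (U.total 0 : ℝ) / U.σ + k := by linarith [abs_nonneg U.index]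
  have hk2 : 0 < (U.total 0 : ℝ) / U.σ + k + U.index := by linarith [neg_abs_le U.index]
  have hk0 : 0 < (U.total 0 : ℝ) / U.σ + k := by linarith
  have hvar := hK.tendsto_integral_abs_stepVar_sub hten haff ha hb hΛ hk1 hk2
  have hv : 0 < U.slope ^ 2 * (U.m * U.limitProportion * (1 - U.limitProportion)) := by
    have h1 : U.slope ≠ 0 := fun h0 => hΛ0 (by rw [index]; rw [slope] at h0; rw [h0, mul_zero])
    have h2 : (0 : ℝ) < U.m := by exact_mod_cast U.one_le_m
    have h3 : 0 < U.limitProportion := by unfold limitProportion; positivity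
    have h4 : 0 < 1 - U.limitProportion := by
      have : 1 - U.limitProportion = U.b 0 / ((U.a U.m : ℝ) + U.b 0) := by
        unfold limitProportion; field_simp; ring
      rw [this]; positivity
    positivity
  have h := hK.isLinearRecursion_centred hten haff
  have hclt := (h.shift k).tendstoInDistribution_div_sqrt (growthProd_pos hk0 hk2)
    (fun n => by
      rw [growthProd_succ, growth_eq]
      push_cast
      ring_nf)
    (tendsto_sum_inv_growthProd_sq hk0 hk2 hΛ) (tendsto_inv_growthProd_sq_div_sum hk0 hk2) hv hvar
  have hV : ∀ n, variance (fun ω' => (U.white K n ω' : ℝ)) P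
      = ∫ ω, ((U.white K n ω : ℝ) - ∫ ω', (U.white K n ω' : ℝ) ∂P) ^ 2 ∂P := fun n =>
    variance_eq_integral (integrable_white hK n).aestronglyMeasurable.aemeasurable
  simp only [hV]
  -- Centering and scaling refer to the unshifted process, so a shift of time does not affect the
  -- limit.
  exact ⟨fun n => ((h.measurable n).div_const _).aemeasurable, by fun_prop,
    (tendsto_add_atTop_iff_nat k).1 hclt.tendsto⟩

end BalancedUrn

theorem mainTheorem6 (U : BalancedUrn) (S : SamplingModel)
    (hten : U.IsTenable S) (haff : U.IsAffine S)
    {Ω : Type*} [MeasurableSpace Ω] (P : Measure Ω) [IsProbabilityMeasure P]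
    (K : ℕ → Ω → Fin (U.m + 1)) (hK : U.IsDrawSequence S P K) :
    -- small-index urns
    (U.a U.m ≠ 0 → U.b 0 ≠ 0 → U.index ≠ 0 → U.index ≤ 1 / 2 →
      TendstoInDistribution
        (fun (n : ℕ) (ω : Ω) =>
          ((U.white K n ω : ℝ) - ∫ ω', (U.white K n ω' : ℝ) ∂P)
            / √(variance (fun ω' => (U.white K n ω' : ℝ)) P))
        atTop (id : ℝ → ℝ) (fun _ => P) (gaussianReal 0 1)) ∧
    -- large-index urns
    (1 / 2 < U.index →
      ∃ L : Ω → ℝ, ConvergesWithMoments P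
        (fun n ω => ((U.white K n ω : ℝ) - ∫ ω', (U.white K n ω' : ℝ) ∂P) / (n : ℝ) ^ U.index) L) ∧
    -- triangular urns, white balls
    (U.a U.m = 0 → 0 < U.index →
      ∃ T : Ω → ℝ, ConvergesWithMoments P
        (fun n ω => (U.white K n ω : ℝ) / (n : ℝ) ^ U.index) T) ∧
    -- triangular urns, black balls
    (U.b 0 = 0 → 0 < U.index →
      ∃ T : Ω → ℝ, ConvergesWithMoments P
        (fun n ω => (U.black K n ω : ℝ) / (n : ℝ) ^ U.index) T) := by
  have hC : 0 ≤ |U.slope| * (U.m : ℝ) := by positivity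
  refine ⟨hK.tendstoInDistribution_white hten haff, fun hΛ =>
    BalancedUrn.exists_convergesWithMoments_of_half_lt
      (hK.isLinearRecursion_centred hten haff) hC hΛ, fun ha hΛ => ?_, fun hb hΛ => ?_⟩
  · exact BalancedUrn.exists_convergesWithMoments_of_var_le
      (hK.isLinearRecursion_white hten haff ha) hC hΛ (hK.stepVar_le_white hten)
  · exact BalancedUrn.exists_convergesWithMoments_of_var_le
      (hK.isLinearRecursion_black hten haff hb) hC hΛ (hK.stepVar_le_black hten)
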